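/- A rank 3 distribution $D=D^r$ on a $(2r+3)$-dimensional manifold generates a special 2-flag of length $r$ if its successive Lie squares $D^{j-1}=[D^j,D^j]$ ($j=r,\dots,1$) are distributions with $\operatorname{rk} D^j=2(r-j)+3$ for $1\le j\le r$ and $D^0$ the whole tangent bundle, and they fit in the Sandwich Diagram: $D^1$ has an involutive corank one subdistribution $F$; for $1\le j<r$ the Cauchy-characteristic module $L(D^j)$ is an involutive corank one subdistribution of $D^{j+1}$; $F\supset L(D^1)\supset L(D^2)\supset\dots\supset L(D^r)=0$. (Here $L(D^j)$ consists of the sections $X$ of $D^j$ with $[X,D^j]\subset D^j$.) The singularity class of such a germ at $p$ is the word $i_1.i_2.\dots.i_r$ over $\{1,2,3\}$ defined as follows. Put $S_2=F$ and $S_j=L(D^{j-2})$ for $3\le j\le r$. The letter $i_1$ is $1$, and for $j\ge 2$ the letter $i_j$ is $1$ iff $D^j(p)\not\subset S_j(p)$. The first letter different from $1$ is $2$. If $i_s\neq 1$ is a later one and $t<s$ is the nearest position before $s$ with $i_t\ne 1$, then $i_s=3$ if $V_{2(s-t-1)+3}(p)\subset S_t(p)$, where $V_1=D^s$, $V_{i+1}=V_i+[D^s,V_i]$,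 and $i_s=2$ otherwise. On $\mathbb R^{17}$ with coordinates $t,x^0,y^0,x^1,y^1,\dots,x^7,y^7$ put $Z[1]=\partial_t+x^1\partial_{x^0}+y^1\partial_{y^0}$, and $$Z[j]=Z[j-1]+x^j\partial_{x^{j-1}}+y^j\partial_{y^{j-1}}\ (j=3,5,7),\qquad Z[j]=x^jZ[j-1]+\partial_{x^{j-1}}+y^j\partial_{y^{j-1}}\ (j=2,4,6),$$ and let $\Delta^7$ be the distribution spanned by $Z[7],\partial_{x^7},\partial_{y^7}$. For $c\in\mathbb R$ let $P_c$ be the point with $x^3=x^5=1$, $x^7=c$ and all other coordinates $0$. Theorem. The singularity class $1.2.1.2.1.2.1$ of special 2-flags of length $7$ contains a continuous modulus of the local classification. Precisely: (1) for every $c\in\mathbb R$ the germ of $\Delta^7$ at $P_c$ generates a special 2-flag of length $7$ of singularity class $1.2.1.2.1.2.1$; (2) for $c\neq c'$ the germs of $\Delta^7$ at $P_c$ and at $P_{c'}$ are not equivalent, i.e. no smooth diffeomorphism from a neighbourhood of $P_c$ onto a neighbourhood of $P_{c'}$ maps $P_c$ to $P_{c'}$ and $\Delta^7$ to $\Delta^7$;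 (3) if a smooth vector field $\mathcal Y=A\partial_t+B\partial_{x^0}+C\partial_{y^0}+\sum_{s=1}^7(F^s\partial_{x^s}+G^s\partial_{y^s})$ on a neighbourhood of $P_c$ satisfies $[\mathcal Y,\Delta^7]\subset\Delta^7$, and all its components except possibly $F^7$ vanish at $P_c$, then at $P_c$ one has $A_t=B_{x^0}=0$ and $F^7(P_c)=3c\,(A_t-B_{x^0})=0$. -/

import Mathlib

open scoped ContDiff Topology

noncomputable section

namespace SpecialFlag

section General

variable {E : Type*} [NormedAddCommGroup E] [NormedSpace ℝ E]

/-- `X` is a smooth vector field on the open set `U` with values in the field of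
subspaces `D`. -/
def IsSection (D : E → Submodule ℝ E) (U : Set E) (X : E → E) : Prop :=
  ContDiffOn ℝ ∞ X U ∧ ∀ q ∈ U, X q ∈ D q

/-- `D` is, over the open set `U`, a smooth distribution of constant rank `k`: its fibres have
dimension `k`, and every vector of a fibre extends to a local smooth section. -/
def IsDistribution (D : E → Submodule ℝ E) (k : ℕ) (U : Set E) : Prop :=
  ∀ q ∈ U, Module.finrank ℝ (D q) = k ∧
    ∀ v ∈ D q, ∃ V : Set E, IsOpen V ∧ q ∈ V ∧ V ⊆ U ∧ ∃ X : E → E, IsSection D V X ∧ X q = v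

/-- `D` is involutive over `U`: Lie brackets of local sections are sections. -/
def IsInvolutive (D : E → Submodule ℝ E) (U : Set E) : Prop :=
  ∀ V : Set E, IsOpen V → V ⊆ U → ∀ X Y : E → E, IsSection D V X → IsSection D V Y →
    IsSection D V (VectorField.lieBracket ℝ X Y)

/-- The vector field `Y` preserves `D` infinitesimally over `U`: `[Y, D] ⊆ D`. -/
def Preserves (Y : E → E) (D : E → Submodule ℝ E) (U : Set E) : Prop :=
  ∀ V : Set E, IsOpen V → V ⊆ U → ∀ X : E → E, IsSection D V X →
    IsSection D V (VectorField.lieBracket ℝ Y X)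

/-- `Y` is an infinitesimal symmetry of `D` on the open set `U`. -/
def IsInfinitesimalSymmetry (D : E → Submodule ℝ E) (U : Set E) (Y : E → E) : Prop :=
  ContDiffOn ℝ ∞ Y U ∧ Preserves Y D U

/-- Generators, over the open set `U`, of the members `V₁ = D`, `V_{i+1} = V_i + [D, V_i]` of the
small flag of `D` (`i = 0` is unused). -/
def smallFlagFields (D : E → Submodule ℝ E) (U : Set E) : ℕ → Set (E → E)
  | 0 => ∅
  | 1 => {X | IsSection D U X}
  | i + 2 => smallFlagFields D U (i + 1) ∪
      {Z | ∃ X Y : E → E, IsSection D U X ∧ Y ∈ smallFlagFields D U (i + 1) ∧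
        Z = VectorField.lieBracket ℝ X Y}

/-- The value `V_i(q)` at `q` of the `i`-th member of the small flag of `D`, for `1 ≤ i`. -/
def smallFlag (D : E → Submodule ℝ E) (i : ℕ) (q : E) : Submodule ℝ E :=
  Submodule.span ℝ {v | ∃ U : Set E, IsOpen U ∧ q ∈ U ∧ ∃ X ∈ smallFlagFields D U i, X q = v}

/-- The Lie square `D + [D, D]`. -/
def lieSquare (D : E → Submodule ℝ E) : E → Submodule ℝ E := smallFlag D 2

/-- The `k`-fold Lie square of `D`. -/
def derivedFlag (D : E → Submodule ℝ E) : ℕ → E → Submodule ℝ E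
  | 0 => D
  | k + 1 => lieSquare (derivedFlag D k)

/-- The member `D^j` (`0 ≤ j ≤ r`) of the flag of `D = D^r`, where `D^{j-1} = [D^j, D^j]`. -/
def flagMember (r : ℕ) (D : E → Submodule ℝ E) (j : ℕ) : E → Submodule ℝ E :=
  derivedFlag D (r - j)

/-- `L(D)`: the values of the Cauchy-characteristic fields of `D`, i.e. the local sections of `D`
that preserve `D` infinitesimally. -/
def cauchyChar (D : E → Submodule ℝ E) (q : E) : Submodule ℝ E :=
  Submodule.span ℝ {v | ∃ U : Set E, IsOpen U ∧ q ∈ U ∧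
    ∃ X : E → E, IsSection D U X ∧ Preserves X D U ∧ X q = v}

/-- The Sandwich Diagram over the open set `U`: `D` is a rank 3 distribution generating there a
special 2-flag of length `r`, with covariant subdistribution `F` of `D^1`. -/
structure IsSpecialTwoFlag (r : ℕ) (D F : E → Submodule ℝ E) (U : Set E) : Prop where
  one_le : 1 ≤ r
  finrank_eq : Module.finrank ℝ E = 2 * r + 3
  flag_zero : ∀ q ∈ U, flagMember r D 0 q = ⊤
  flag_rank : ∀ j, 1 ≤ j → j ≤ r → IsDistribution (flagMember r D j) (2 * (r - j) + 3) U
  cov_rank : IsDistribution F (2 * r) U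
  cov_le : ∀ q ∈ U, F q ≤ flagMember r D 1 q
  cov_involutive : IsInvolutive F U
  cauchy_rank : ∀ j, 1 ≤ j → j < r → IsDistribution (cauchyChar (flagMember r D j)) (2 * (r - j)) U
  cauchy_le : ∀ j, 1 ≤ j → j < r → ∀ q ∈ U,
    cauchyChar (flagMember r D j) q ≤ flagMember r D (j + 1) q
  cauchy_involutive : ∀ j, 1 ≤ j → j < r → IsInvolutive (cauchyChar (flagMember r D j)) U
  cauchy_le_cov : 2 ≤ r → ∀ q ∈ U, cauchyChar (flagMember r D 1) q ≤ F q
  cauchy_antitone : ∀ j, 1 ≤ j → j < r → ∀ q ∈ U,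
    cauchyChar (flagMember r D (j + 1)) q ≤ cauchyChar (flagMember r D j) q
  cauchy_last : ∀ q ∈ U, cauchyChar D q = ⊥

/-- The lower left vertex of the sandwich indexed by `D^j`: `F` for `j = 2`, and `L(D^{j-2})`
for `3 ≤ j`. -/
def sandwichSpace (r : ℕ) (D F : E → Submodule ℝ E) (j : ℕ) : E → Submodule ℝ E :=
  if j = 2 then F else cauchyChar (flagMember r D (j - 2))

/-- The `j`-th letter of the sandwich class at `p` is not `1`: the `j`-th sandwich is not
transverse at `p`. -/
def IsCrossed (r : ℕ) (D F : E → Submodule ℝ E) (p : E) (j : ℕ) : Prop :=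
  2 ≤ j ∧ flagMember r D j p ≤ sandwichSpace r D F j p

/-- A non-transverse letter at position `s` is to be specified to `3`: with `t` the nearest
non-transverse position before `s`, separated from it by `l = s - t - 1` letters `1`, the member
`V_{2l+3}` of the small flag of `D^s` is contained, at `p`, in the space in the `t`-th sandwich.
(For the first non-transverse letter there is no `t`, and the letter is `2`.) -/
def IsThree (r : ℕ) (D F : E → Submodule ℝ E) (p : E) (s : ℕ) : Prop :=
  ∃ t, t < s ∧ IsCrossed r D F p t ∧ (∀ u, t < u → u < s → ¬ IsCrossed r D F p u) ∧
    smallFlag (flagMember r D s) (2 * (s - t - 1) + 3) p ≤ sandwichSpace r D F t p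

open Classical in
/-- The `j`-th letter of the singularity class at `p`. -/
def singularityLetter (r : ℕ) (D F : E → Submodule ℝ E) (p : E) (j : ℕ) : ℕ :=
  if IsCrossed r D F p j then (if IsThree r D F p j then 3 else 2) else 1

/-- The germ of `D` at `p` generates a special 2-flag of length `r` whose singularity class is
the word `w`. -/
def HasSingularityClass (r : ℕ) (D : E → Submodule ℝ E) (p : E) (w : List ℕ) : Prop :=
  ∃ (U : Set E) (F : E → Submodule ℝ E), IsOpen U ∧ p ∈ U ∧ IsSpecialTwoFlag r D F U ∧
    w.length = r ∧ ∀ j, 1 ≤ j → j ≤ r → w.getD (j - 1) 1 = singularityLetter r D F p j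

/-- The germs of `D` at `p` and of `D'` at `p'` are equivalent: a smooth diffeomorphism between
neighbourhoods of `p` and `p'` maps `p` to `p'` and `D` onto `D'`. -/
def GermEquivalent (D : E → Submodule ℝ E) (p : E) (D' : E → Submodule ℝ E) (p' : E) : Prop :=
  ∃ φ : OpenPartialHomeomorph E E, p ∈ φ.source ∧ φ p = p' ∧
    ContDiffOn ℝ ∞ φ φ.source ∧ ContDiffOn ℝ ∞ φ.symm φ.target ∧
    ∀ q ∈ φ.source, (D q).map (fderiv ℝ φ q : E →ₗ[ℝ] E) = D' (φ q)

end General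

/-- The space `ℝ^{2r+3}` with coordinates `t, x⁰, y⁰, x¹, y¹, …, x^r, y^r`, in this order. -/
abbrev EKRSpace (r : ℕ) : Type := Fin (2 * r + 3) → ℝ

/-- The index of the coordinate `t`. -/
def tIdx (r : ℕ) : Fin (2 * r + 3) := Fin.ofNat (2 * r + 3) 0

/-- The index of the coordinate `x^j`, for `j ≤ r`. -/
def xIdx (r j : ℕ) : Fin (2 * r + 3) := Fin.ofNat (2 * r + 3) (2 * j + 1)

/-- The index of the coordinate `y^j`, for `j ≤ r`. -/
def yIdx (r j : ℕ) : Fin (2 * r + 3) := Fin.ofNat (2 * r + 3) (2 * j + 2)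

/-- The coordinate vector in the direction of the coordinate with index `k`. -/
def partialVec {r : ℕ} (k : Fin (2 * r + 3)) : EKRSpace r := Pi.single k 1

/-- The vector fields `Z[j]`, `1 ≤ j ≤ r`, of a word `w = i₁ i₂ … i_r` over `{1, 2, 3}` (the letter
`i_{j+1}` is the entry of `w` at position `j` counted from `0`). For `i₁ = 1` the convention
`Z[0] = ∂_t` gives `Z[1] = ∂_t + x¹ ∂_{x⁰} + y¹ ∂_{y⁰}`. -/
def ekrField (r : ℕ) (w : List ℕ) : ℕ → EKRSpace r → EKRSpace r
  | 0 => fun _ => partialVec (tIdx r)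
  | j + 1 => fun q =>
      match w.getD j 1 with
      | 2 => q (xIdx r (j + 1)) • ekrField r w j q + partialVec (xIdx r j)
          + q (yIdx r (j + 1)) • partialVec (yIdx r j)
      | 3 => q (xIdx r (j + 1)) • ekrField r w j q + q (yIdx r (j + 1)) • partialVec (xIdx r j)
          + partialVec (yIdx r j)
      | _ => ekrField r w j q + q (xIdx r (j + 1)) • partialVec (xIdx r j)
          + q (yIdx r (j + 1)) • partialVec (yIdx r j)

/-- The distribution `Δ^r = (Z[r], ∂_{x^r}, ∂_{y^r})` of the word `w` of length `r`. -/
def ekrDistribution (r : ℕ) (w : List ℕ) (q : EKRSpace r) : Submodule ℝ (EKRSpace r) :=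
  Submodule.span ℝ {ekrField r w r q, partialVec (xIdx r r), partialVec (yIdx r r)}

/-- The word `1.2.1.2.1.2.1`. -/
def code7 : List ℕ := [1, 2, 1, 2, 1, 2, 1]

/-- The distribution `Δ^7` on `ℝ^17` of the word `1.2.1.2.1.2.1`. -/
def Delta7 : EKRSpace 7 → Submodule ℝ (EKRSpace 7) := ekrDistribution 7 code7

/-- The point `P_c`: `x³ = x⁵ = 1`, `x⁷ = c`, all other coordinates are `0`. -/
def pointP (c : ℝ) : EKRSpace 7 :=
  partialVec (xIdx 7 3) + partialVec (xIdx 7 5) + c • partialVec (xIdx 7 7)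

end SpecialFlag

end

noncomputable section

namespace SpecialFlag

/-! ### The fields Z[j], the vertical flag and the candidates for the members D^j. -/

section Fields

variable {r : ℕ} {w : List ℕ}

/-! Level k consists of the coordinates x^k, y^k (with t below them all). The member D^j is Z[j]
together with the vectors having no component below level j (`vertical r j`). Modulo D^j the bracket
of two sections depends only on their values: it is the derivative of Z[j] along a vertical
combination of them (`lieBracket_section_sub_mem`). For j ≥ 1, that derivative on `vertical r j` has
kernel `vertical r (j + 1)` modulo D^j and fills D^{j-1} modulo D^j (`fderiv_ekrField_succ_mem`).
Hence the Lie squares are as expected, L(D^j) is `vertical r (j + 1)`, and `vertical r 1` serves as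
F. A letter differs from 1 exactly where Z[j] becomes vertical of level j-1, and an explicit
fourfold bracket excludes the letter 3.

A diffeomorphism φ preserving D preserves all D^j and all vertical spaces of level at least 1, so
φ_* Z[j] = a_j Z[j] modulo `vertical r j`, where a_j is `pushCoeff`. Writing X^k for x^k ∘ φ, the
components of these identities give, for j ≥ 1: x^{j+1} a_j = a_{j+1} X^{j+1} if the letter j+1 is
2; a_{j+1} = a_j if the letter j+1 is 1; x^{j+2} a_j = a_{j+1}^2 X^{j+2} on x^{j+1} = 0, for the
letters 2.1 at j+1, j+2 (differentiate the first along Z[j+2]); a_j = a_{j+1}^2 a_{j+3} where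
x^{j+1} = x^{j+3} = y^{j+3} = 0, for the letters 2.1.2 (differentiate once more, along x^{j+2}). At
P_c, where x^3 = x^5 = 1 in source and target, a_1 = a_2^2 = a_2^2 a_4 forces a_4 = 1, then a_3 =
a_4^2 = a_4^2 a_6 forces a_6 = 1. Since a_5 = a_4, the relation c a_5 = a_6^2 c' becomes c = c'.

The statement on infinitesimal symmetries is the linearisation of this computation: b_j, the
coefficient of Z[j] in [Z[j], Y], replaces a_j, products become sums, and the same positions of the
word force every b_j that matters to vanish. -/

theorem xIdx_val {j : ℕ} (h : j ≤ r) : (xIdx r j).val = 2 * j + 1 :=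
  Nat.mod_eq_of_lt (by omega)

theorem yIdx_val {j : ℕ} (h : j ≤ r) : (yIdx r j).val = 2 * j + 2 :=
  Nat.mod_eq_of_lt (by omega)

theorem tIdx_val : (tIdx r).val = 0 := rfl

/-- The vectors whose coordinates of level below `j` vanish. -/
def vertical (r j : ℕ) : Submodule ℝ (EKRSpace r) where
  carrier := {v | ∀ k : Fin (2 * r + 3), k.val < 2 * j + 1 → v k = 0}
  add_mem' := fun {a b} ha hb k hk => by simp [ha k hk, hb k hk]
  zero_mem' := fun k _ => rfl
  smul_mem' := fun c v hv k hk => by simp [hv k hk]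

theorem mem_vertical {j : ℕ} {v : EKRSpace r} :
    v ∈ vertical r j ↔ ∀ k : Fin (2 * r + 3), k.val < 2 * j + 1 → v k = 0 := Iff.rfl

theorem vertical_antitone {i j : ℕ} (h : i ≤ j) : vertical r j ≤ vertical r i :=
  fun _ hv k hk => hv k (by omega)

theorem partialVec_self (k : Fin (2 * r + 3)) : (partialVec k : EKRSpace r) k = 1 := by
  simp [partialVec]

theorem partialVec_of_ne {k l : Fin (2 * r + 3)} (h : l ≠ k) :
    (partialVec k : EKRSpace r) l = 0 := by
  simp [partialVec, h]

theorem partialVec_mem_vertical {j : ℕ} {k : Fin (2 * r + 3)} (h : 2 * j + 1 ≤ k.val) :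
    (partialVec k : EKRSpace r) ∈ vertical r j := fun l hl =>
  partialVec_of_ne (by rintro rfl; omega)

theorem mem_vertical_succ {j : ℕ} (hj : j ≤ r) {v : EKRSpace r} :
    v ∈ vertical r (j + 1) ↔ v ∈ vertical r j ∧ v (xIdx r j) = 0 ∧ v (yIdx r j) = 0 := by
  constructor
  · intro h
    exact ⟨vertical_antitone (Nat.le_succ j) h, h _ (by rw [xIdx_val hj]; omega),
      h _ (by rw [yIdx_val hj]; omega)⟩
  · rintro ⟨h, hx, hy⟩ k hk
    by_cases h1 : k.val < 2 * j + 1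
    · exact h k h1
    · by_cases h2 : k.val = 2 * j + 1
      · rw [show k = xIdx r j from Fin.ext (by rw [xIdx_val hj, h2])]; exact hx
      · rw [show k = yIdx r j from Fin.ext (by rw [yIdx_val hj]; omega)]; exact hy

theorem finrank_vertical {j : ℕ} (hj : j ≤ r + 1) :
    Module.finrank ℝ (vertical r j) = 2 * (r + 1 - j) := by
  let I : Set (Fin (2 * r + 3)) := {k | 2 * j + 1 ≤ k.val}
  let J : Set (Fin (2 * r + 3)) := {k | k.val < 2 * j + 1}
  have hI : Disjoint I J := Set.disjoint_left.2 fun k (h : 2 * j + 1 ≤ k.val)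
    (h' : k.val < 2 * j + 1) => by omega
  have hIJ : Set.univ ⊆ I ∪ J := fun k _ => by
    rcases Nat.lt_or_ge k.val (2 * j + 1) with h | h
    · exact Or.inr h
    · exact Or.inl h
  have e := LinearMap.iInfKerProjEquiv ℝ (fun _ : Fin (2 * r + 3) => ℝ) hI hIJ
  have hv : vertical r j = ⨅ i ∈ J, LinearMap.ker
      (LinearMap.proj i : (∀ _ : Fin (2 * r + 3), ℝ) →ₗ[ℝ] ℝ) := by
    ext v
    simp only [Submodule.mem_iInf, LinearMap.mem_ker, LinearMap.proj_apply]
    exact Iff.rfl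
  rw [hv, e.finrank_eq, Module.finrank_pi]
  have : Fintype.card I = Fintype.card (Fin (2 * (r + 1 - j))) := by
    refine Fintype.card_congr
      { toFun := fun k => ⟨k.1.val - (2 * j + 1), ?_⟩
        invFun := fun k => ⟨⟨k.val + (2 * j + 1), by omega⟩, ?_⟩
        left_inv := ?_
        right_inv := ?_ }
    · have h1 : 2 * j + 1 ≤ k.1.val := k.2
      have h2 := k.1.isLt
      omega
    · change 2 * j + 1 ≤ k.val + (2 * j + 1)
      omega
    · intro k
      have h1 : 2 * j + 1 ≤ k.1.val := k.2
      apply Subtype.ext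
      apply Fin.ext
      change k.1.val - (2 * j + 1) + (2 * j + 1) = k.1.val
      omega
    · intro k
      apply Fin.ext
      simp
  rw [this, Fintype.card_fin]

theorem ekrField_succ_two {j : ℕ} (h : w.getD j 1 = 2) (q : EKRSpace r) :
    ekrField r w (j + 1) q = q (xIdx r (j + 1)) • ekrField r w j q + partialVec (xIdx r j)
      + q (yIdx r (j + 1)) • partialVec (yIdx r j) := by
  simp only [ekrField, h]

theorem ekrField_succ_three {j : ℕ} (h : w.getD j 1 = 3) (q : EKRSpace r) :
    ekrField r w (j + 1) q = q (xIdx r (j + 1)) • ekrField r w j q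
      + q (yIdx r (j + 1)) • partialVec (xIdx r j) + partialVec (yIdx r j) := by
  simp only [ekrField, h]

theorem ekrField_succ_one {j : ℕ} (h2 : w.getD j 1 ≠ 2) (h3 : w.getD j 1 ≠ 3) (q : EKRSpace r) :
    ekrField r w (j + 1) q = ekrField r w j q + q (xIdx r (j + 1)) • partialVec (xIdx r j)
      + q (yIdx r (j + 1)) • partialVec (yIdx r j) := by
  simp only [ekrField]

/-- The index of a coordinate of `Z[j]` that is identically `1`. -/
def pivot (r : ℕ) (w : List ℕ) : ℕ → Fin (2 * r + 3)
  | 0 => tIdx r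
  | j + 1 => if w.getD j 1 = 2 then xIdx r j else if w.getD j 1 = 3 then yIdx r j else pivot r w j

theorem pivot_val_lt {j : ℕ} (hj : j ≤ r) : (pivot r w j).val < 2 * j + 1 := by
  induction j with
  | zero => simp [pivot, tIdx_val]
  | succ j ih =>
    have := ih (by omega)
    rw [pivot]
    split_ifs
    · rw [xIdx_val (by omega)]; omega
    · rw [yIdx_val (by omega)]; omega
    · omega

theorem ekrField_apply_eq_zero {j : ℕ} (hj : j ≤ r) (q : EKRSpace r) {k : Fin (2 * r + 3)}
    (hk : 2 * j + 1 ≤ k.val) : ekrField r w j q k = 0 := by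
  induction j with
  | zero =>
    exact partialVec_of_ne fun h => by rw [h, tIdx_val] at hk; omega
  | succ j ih =>
    have h0 := ih (by omega) (by omega)
    have hx : (partialVec (xIdx r j) : EKRSpace r) k = 0 := partialVec_of_ne fun h => by
      rw [h, xIdx_val (by omega)] at hk; omega
    have hy : (partialVec (yIdx r j) : EKRSpace r) k = 0 := partialVec_of_ne fun h => by
      rw [h, yIdx_val (by omega)] at hk; omega
    by_cases h2 : w.getD j 1 = 2
    · simp [ekrField_succ_two h2, h0, hx, hy]
    by_cases h3 : w.getD j 1 = 3
    · simp [ekrField_succ_three h3, h0, hx, hy]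
    · simp [ekrField_succ_one h2 h3, h0, hx, hy]

theorem xIdx_ne_yIdx {i j : ℕ} (hi : i ≤ r) (hj : j ≤ r) : xIdx r i ≠ yIdx r j := fun h => by
  have := congrArg Fin.val h
  rw [xIdx_val hi, yIdx_val hj] at this
  omega

theorem pivot_ne {j : ℕ} (hj : j ≤ r) : pivot r w j ≠ xIdx r j ∧ pivot r w j ≠ yIdx r j := by
  have := pivot_val_lt (w := w) hj
  constructor <;> intro h <;> have h' := congrArg Fin.val h
  · rw [xIdx_val hj] at h'; omega
  · rw [yIdx_val hj] at h'; omega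

theorem ekrField_pivot {j : ℕ} (hj : j ≤ r) (q : EKRSpace r) :
    ekrField r w j q (pivot r w j) = 1 := by
  induction j with
  | zero => exact partialVec_self _
  | succ j ih =>
    have h0 := ih (by omega)
    have hjr : j ≤ r := by omega
    have hxy := xIdx_ne_yIdx hjr hjr
    obtain ⟨hpx, hpy⟩ := pivot_ne (w := w) hjr
    have zx : ekrField r w j q (xIdx r j) = 0 :=
      ekrField_apply_eq_zero hjr q (by rw [xIdx_val hjr])
    have zy : ekrField r w j q (yIdx r j) = 0 :=
      ekrField_apply_eq_zero hjr q (by rw [yIdx_val hjr]; omega)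
    by_cases h2 : w.getD j 1 = 2
    · simp [ekrField_succ_two h2, pivot, h2, zx, partialVec_self, partialVec_of_ne hxy,
        -List.getD_eq_getElem?_getD]
    by_cases h3 : w.getD j 1 = 3
    · simp [ekrField_succ_three h3, pivot, h3, zy, partialVec_self,
        partialVec_of_ne hxy.symm, -List.getD_eq_getElem?_getD]
    · simp [ekrField_succ_one h2 h3, pivot, h2, h3, h0, partialVec_of_ne hpx,
        partialVec_of_ne hpy, -List.getD_eq_getElem?_getD]

/-- `Z[j+1]` is an affine combination, with coefficients `1, x^{j+1}, y^{j+1}`, of a rearrangement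
of the fields `Z[j], ∂_{x^j}, ∂_{y^j}`, which is dual to a triple of coordinates. -/
theorem exists_frame (w : List ℕ) {j : ℕ} (hj : j ≤ r) :
    ∃ (A B C : EKRSpace r → EKRSpace r) (b c : Fin (2 * r + 3)),
      (∀ q, ekrField r w (j + 1) q
        = A q + q (xIdx r (j + 1)) • B q + q (yIdx r (j + 1)) • C q) ∧
      b.val < 2 * j + 3 ∧ c.val < 2 * j + 3 ∧
      (∀ q, A q (pivot r w (j + 1)) = 1 ∧ B q (pivot r w (j + 1)) = 0 ∧
        C q (pivot r w (j + 1)) = 0) ∧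
      (∀ q, B q b = 1 ∧ C q b = 0) ∧ (∀ q, B q c = 0 ∧ C q c = 1) ∧
      ({A, B, C} : Set (EKRSpace r → EKRSpace r))
        = {ekrField r w j, fun _ => partialVec (xIdx r j), fun _ => partialVec (yIdx r j)} := by
  have hxy := xIdx_ne_yIdx hj hj
  obtain ⟨hpx, hpy⟩ := pivot_ne (w := w) hj
  have hp := pivot_val_lt (w := w) hj
  have hxv := xIdx_val hj
  have hyv := yIdx_val hj
  have zx : ∀ q, ekrField r w j q (xIdx r j) = 0 := fun q =>
    ekrField_apply_eq_zero hj q (by rw [xIdx_val hj])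
  have zy : ∀ q, ekrField r w j q (yIdx r j) = 0 := fun q =>
    ekrField_apply_eq_zero hj q (by rw [yIdx_val hj]; omega)
  have zp : ∀ q, ekrField r w j q (pivot r w j) = 1 := fun q => ekrField_pivot hj q
  by_cases h2 : w.getD j 1 = 2
  · have e : pivot r w (j + 1) = xIdx r j := by rw [pivot, if_pos h2]
    refine ⟨fun _ => partialVec (xIdx r j), ekrField r w j, fun _ => partialVec (yIdx r j),
      pivot r w j, yIdx r j, fun q => by rw [ekrField_succ_two h2]; abel, by omega, by omega,
      fun q => ?_, fun q => ?_, fun q => ?_, Set.insert_comm _ _ _⟩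
    · simp [e, zx, partialVec_self, partialVec_of_ne hxy]
    · simp [zp, partialVec_of_ne hpy]
    · simp [zy, partialVec_self]
  by_cases h3 : w.getD j 1 = 3
  · have e : pivot r w (j + 1) = yIdx r j := by rw [pivot, if_neg h2, if_pos h3]
    refine ⟨fun _ => partialVec (yIdx r j), ekrField r w j, fun _ => partialVec (xIdx r j),
      pivot r w j, xIdx r j, fun q => by rw [ekrField_succ_three h3]; abel, by omega, by omega,
      fun q => ?_, fun q => ?_, fun q => ?_, ?_⟩
    · simp [e, zy, partialVec_self, partialVec_of_ne hxy.symm]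
    · simp [zp, partialVec_of_ne hpx]
    · simp [zx, partialVec_self]
    · rw [Set.insert_comm]
      congr 1
      exact Set.pair_comm _ _
  · have e : pivot r w (j + 1) = pivot r w j := by rw [pivot, if_neg h2, if_neg h3]
    refine ⟨ekrField r w j, fun _ => partialVec (xIdx r j), fun _ => partialVec (yIdx r j),
      xIdx r j, yIdx r j, fun q => by rw [ekrField_succ_one h2 h3], by omega, by omega,
      fun q => ?_, fun q => ?_, fun q => ?_, rfl⟩
    · simp [e, zp, partialVec_of_ne hpx, partialVec_of_ne hpy]
    · simp [partialVec_self, partialVec_of_ne hxy]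
    · simp [partialVec_self, partialVec_of_ne hxy.symm]

theorem contDiff_ekrField (r : ℕ) (w : List ℕ) (j : ℕ) : ContDiff ℝ ∞ (ekrField r w j) := by
  induction j with
  | zero => exact contDiff_const
  | succ j ih =>
    have hc : ∀ k : Fin (2 * r + 3), ContDiff ℝ ∞ fun q : EKRSpace r => q k :=
      fun k => contDiff_apply ℝ ℝ k
    by_cases h2 : w.getD j 1 = 2
    · rw [funext fun q => ekrField_succ_two h2 q]
      exact (((hc _).smul ih).add contDiff_const).add ((hc _).smul contDiff_const)
    by_cases h3 : w.getD j 1 = 3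
    · rw [funext fun q => ekrField_succ_three h3 q]
      exact (((hc _).smul ih).add ((hc _).smul contDiff_const)).add contDiff_const
    · rw [funext fun q => ekrField_succ_one h2 h3 q]
      exact (ih.add ((hc _).smul contDiff_const)).add ((hc _).smul contDiff_const)

theorem differentiable_ekrField (j : ℕ) : Differentiable ℝ (ekrField r w j) :=
  (contDiff_ekrField r w j).differentiable (by simp)

theorem fderiv_coord (k : Fin (2 * r + 3)) (q v : EKRSpace r) :
    fderiv ℝ (fun q : EKRSpace r => q k) q v = v k := by
  have := (ContinuousLinearMap.proj (R := ℝ) (φ := fun _ : Fin (2 * r + 3) => ℝ) k).hasFDerivAt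
    (x := q)
  exact congrArg (fun L => L v) this.fderiv

theorem fderiv_affine_frame {A B C : EKRSpace r → EKRSpace r} {k l : Fin (2 * r + 3)}
    {q : EKRSpace r} (hA : DifferentiableAt ℝ A q) (hB : DifferentiableAt ℝ B q)
    (hC : DifferentiableAt ℝ C q) (v : EKRSpace r) :
    fderiv ℝ (fun q => A q + q k • B q + q l • C q) q v
      = fderiv ℝ A q v + (q k • fderiv ℝ B q v + v k • B q)
        + (q l • fderiv ℝ C q v + v l • C q) := by
  have hc : ∀ k : Fin (2 * r + 3), DifferentiableAt ℝ (fun q : EKRSpace r => q k) q :=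
    fun k => differentiableAt_apply k q
  have e1 := ((hA.hasFDerivAt.add ((hc k).hasFDerivAt.smul hB.hasFDerivAt)).add
    ((hc l).hasFDerivAt.smul hC.hasFDerivAt)).fderiv
  have e2 := congrArg (fun L => L v) e1
  simp only [add_apply, smul_apply, ContinuousLinearMap.smulRight_apply, fderiv_coord] at e2
  exact e2

/-- Only coordinates of level at most j enter the coefficients of Z[j]. -/
theorem fderiv_ekrField_eq_zero {j : ℕ} (hj : j ≤ r) (q : EKRSpace r) {v : EKRSpace r}
    (hv : v ∈ vertical r (j + 1)) : fderiv ℝ (ekrField r w j) q v = 0 := by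
  induction j with
  | zero =>
    have : ekrField r w 0 = fun _ => partialVec (tIdx r) := rfl
    simp [this]
  | succ j ih =>
    obtain ⟨A, B, C, b, c, hZ, -, -, -, -, -, hS⟩ := exists_frame w (j := j) (r := r) (by omega)
    have h0 := ih (by omega) (vertical_antitone (by omega) hv)
    have key : ∀ f ∈ ({A, B, C} : Set (EKRSpace r → EKRSpace r)),
        DifferentiableAt ℝ f q ∧ fderiv ℝ f q v = 0 := by
      rw [hS]
      rintro f (rfl | rfl | rfl)
      · exact ⟨differentiable_ekrField j q, h0⟩
      · simp
      · simp
    obtain ⟨-, hx, hy⟩ := (mem_vertical_succ hj).1 hv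
    have kA := key A (by simp)
    have kB := key B (by simp)
    have kC := key C (by simp)
    rw [funext hZ, fderiv_affine_frame kA.1 kB.1 kC.1]
    simp [kA.2, kB.2, kC.2, hx, hy]

/-- The member `D^j` of the flag: the span of `Z[j]` and of the vectors vertical over level
`j - 1`. -/
def ekrFlag (r : ℕ) (w : List ℕ) (j : ℕ) (q : EKRSpace r) : Submodule ℝ (EKRSpace r) where
  carrier := {v | ∀ k : Fin (2 * r + 3), k.val < 2 * j + 1 →
    v k = v (pivot r w j) * ekrField r w j q k}
  add_mem' := fun {a b} ha hb k hk => by simp only [Pi.add_apply, ha k hk, hb k hk]; ring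
  zero_mem' := fun k _ => by simp
  smul_mem' := fun c v hv k hk => by simp only [Pi.smul_apply, smul_eq_mul, hv k hk]; ring

theorem mem_ekrFlag {j : ℕ} {q v : EKRSpace r} : v ∈ ekrFlag r w j q ↔
    ∀ k : Fin (2 * r + 3), k.val < 2 * j + 1 → v k = v (pivot r w j) * ekrField r w j q k :=
  Iff.rfl

theorem vertical_le_ekrFlag {j : ℕ} (hj : j ≤ r) (q : EKRSpace r) :
    vertical r j ≤ ekrFlag r w j q := fun v hv k hk => by
  rw [hv k hk, hv _ (pivot_val_lt hj), zero_mul]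

theorem ekrField_mem_ekrFlag {j : ℕ} (hj : j ≤ r) (q : EKRSpace r) :
    ekrField r w j q ∈ ekrFlag r w j q := fun k _ => by
  rw [ekrField_pivot hj, one_mul]

theorem mem_ekrFlag_iff_sub_mem {j : ℕ} {q v : EKRSpace r} : v ∈ ekrFlag r w j q ↔
    v - v (pivot r w j) • ekrField r w j q ∈ vertical r j := by
  rw [mem_ekrFlag, mem_vertical]
  simp [sub_eq_zero]

theorem mem_vertical_of_mem_ekrFlag {j : ℕ} {q v : EKRSpace r} (h : v ∈ ekrFlag r w j q)
    (h0 : v (pivot r w j) = 0) : v ∈ vertical r j := fun k hk => by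
  rw [h k hk, h0, zero_mul]

theorem ekrFlag_eq_sup {j : ℕ} (hj : j ≤ r) (q : EKRSpace r) :
    ekrFlag r w j q = vertical r j ⊔ Submodule.span ℝ {ekrField r w j q} := by
  apply le_antisymm
  · intro v hv
    have h := mem_ekrFlag_iff_sub_mem.1 hv
    rw [← sub_add_cancel v (v (pivot r w j) • ekrField r w j q)]
    exact Submodule.add_mem_sup h
      (Submodule.smul_mem _ _ (Submodule.mem_span_singleton_self _))
  · refine sup_le (vertical_le_ekrFlag hj q) ?_
    rw [Submodule.span_singleton_le_iff_mem]
    exact ekrField_mem_ekrFlag hj q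

theorem ekrField_notMem_vertical {j : ℕ} (hj : j ≤ r) (q : EKRSpace r) :
    ekrField r w j q ∉ vertical r j := fun h => by
  have := h _ (pivot_val_lt (w := w) hj)
  rw [ekrField_pivot hj] at this
  exact one_ne_zero this

theorem finrank_ekrFlag {j : ℕ} (hj : j ≤ r) (q : EKRSpace r) :
    Module.finrank ℝ (ekrFlag r w j q) = 2 * (r - j) + 3 := by
  have hne : ekrField r w j q ≠ 0 := fun h => by
    have := ekrField_pivot (w := w) hj q
    simp [h] at this
  have h := Submodule.finrank_sup_add_finrank_inf_eq (vertical r j)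
    (Submodule.span ℝ {ekrField r w j q})
  have hinf : vertical r j ⊓ Submodule.span ℝ {ekrField r w j q} = ⊥ := by
    rw [eq_bot_iff]
    rintro v ⟨hv, hv'⟩
    obtain ⟨a, rfl⟩ := Submodule.mem_span_singleton.1 hv'
    have := hv _ (pivot_val_lt (w := w) hj)
    rw [Pi.smul_apply, ekrField_pivot hj, smul_eq_mul, mul_one] at this
    simp [this]
  rw [hinf, finrank_bot, finrank_vertical (by omega), finrank_span_singleton hne,
    ← ekrFlag_eq_sup hj] at h
  omega

theorem ekrFlag_zero (q : EKRSpace r) : ekrFlag r w 0 q = ⊤ := by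
  rw [eq_top_iff]
  intro v _ k hk
  have : k = tIdx r := Fin.ext (by rw [tIdx_val]; omega)
  subst this
  change v (tIdx r) = v (tIdx r) * (partialVec (tIdx r) : EKRSpace r) (tIdx r)
  rw [partialVec_self, mul_one]

theorem ekrFlag_succ_le {j : ℕ} (hj : j + 1 ≤ r) (q : EKRSpace r) :
    ekrFlag r w (j + 1) q ≤ ekrFlag r w j q := by
  have hj' : j ≤ r := by omega
  rw [ekrFlag_eq_sup hj]
  have hv := vertical_le_ekrFlag (w := w) hj' q
  refine sup_le ((vertical_antitone (Nat.le_succ j)).trans hv) ?_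
  rw [Submodule.span_singleton_le_iff_mem]
  obtain ⟨A, B, C, b, c, hZ, -, -, -, -, -, hS⟩ := exists_frame w hj'
  have key : ∀ f ∈ ({A, B, C} : Set (EKRSpace r → EKRSpace r)), f q ∈ ekrFlag r w j q := by
    rw [hS]
    rintro f (rfl | rfl | rfl)
    · exact ekrField_mem_ekrFlag hj' q
    · exact hv (partialVec_mem_vertical (by rw [xIdx_val hj']))
    · exact hv (partialVec_mem_vertical (by rw [yIdx_val hj']; omega))
  rw [hZ]
  exact add_mem (add_mem (key A (by simp)) (Submodule.smul_mem _ _ (key B (by simp))))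
    (Submodule.smul_mem _ _ (key C (by simp)))

/-- The derivative of `Z[j+1]` along vertical vectors takes values in `D^j`, is injective modulo
`D^{j+1}`, and spans `D^j` modulo `D^{j+1}`. -/
theorem fderiv_ekrField_succ_mem {j : ℕ} (hj : j + 1 ≤ r) (q : EKRSpace r) {v : EKRSpace r}
    (hv : v ∈ vertical r (j + 1)) :
    fderiv ℝ (ekrField r w (j + 1)) q v ∈ ekrFlag r w j q ∧
    (fderiv ℝ (ekrField r w (j + 1)) q v ∈ ekrFlag r w (j + 1) q → v ∈ vertical r (j + 2)) ∧
    ∀ u ∈ ekrFlag r w j q, ∃ l ∈ vertical r (j + 1),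
      u - fderiv ℝ (ekrField r w (j + 1)) q l ∈ ekrFlag r w (j + 1) q := by
  have hj' : j ≤ r := by omega
  have hvle := vertical_le_ekrFlag (w := w) hj' q
  obtain ⟨A, B, C, b, c, hZ, hb, hc, hAp, hBC, hBC', hS⟩ := exists_frame w hj'
  have key : ∀ f ∈ ({A, B, C} : Set (EKRSpace r → EKRSpace r)), f q ∈ ekrFlag r w j q ∧
      DifferentiableAt ℝ f q ∧ ∀ v ∈ vertical r (j + 1), fderiv ℝ f q v = 0 := by
    rw [hS]
    rintro f (rfl | rfl | rfl)
    · exact ⟨ekrField_mem_ekrFlag hj' q, differentiable_ekrField j q,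
        fun v hv => fderiv_ekrField_eq_zero hj' q hv⟩
    · exact ⟨hvle (partialVec_mem_vertical (by rw [xIdx_val hj'])), by simp, by simp⟩
    · exact ⟨hvle (partialVec_mem_vertical (by rw [yIdx_val hj']; omega)), by simp, by simp⟩
  have kA := key A (by simp)
  have kB := key B (by simp)
  have kC := key C (by simp)
  -- The frame fields do not depend on levels above j, so only the affine coefficients x^{j+1},
  -- y^{j+1} are differentiated.
  have hd : ∀ v ∈ vertical r (j + 1), fderiv ℝ (ekrField r w (j + 1)) q v
      = v (xIdx r (j + 1)) • B q + v (yIdx r (j + 1)) • C q := by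
    intro v hv
    rw [funext hZ, fderiv_affine_frame kA.2.1 kB.2.1 kC.2.1, kA.2.2 v hv, kB.2.2 v hv,
      kC.2.2 v hv]
    simp
  refine ⟨?_, ?_, ?_⟩
  · rw [hd v hv]
    exact add_mem (Submodule.smul_mem _ _ kB.1) (Submodule.smul_mem _ _ kC.1)
  · rw [hd v hv]
    intro h
    -- The derivative has zero pivot component, so inside D^{j+1} it must be vertical; the
    -- coordinates b and c, dual to B and C, then read off both coefficients as zero.
    have h0 := mem_vertical_of_mem_ekrFlag h (by simp [hAp])
    have h1 := h0 b (by omega)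
    have h2 := h0 c (by omega)
    simp only [Pi.add_apply, Pi.smul_apply, hBC, hBC', smul_eq_mul, mul_one, mul_zero, add_zero,
      zero_add] at h1 h2
    exact (mem_vertical_succ hj).2 ⟨hv, h1, h2⟩
  · have hxv := xIdx_val hj
    have hyv := yIdx_val hj
    have mx : (partialVec (xIdx r (j + 1)) : EKRSpace r) ∈ vertical r (j + 1) :=
      partialVec_mem_vertical (by omega)
    have my : (partialVec (yIdx r (j + 1)) : EKRSpace r) ∈ vertical r (j + 1) :=
      partialVec_mem_vertical (by omega)
    have hxy := xIdx_ne_yIdx hj hj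
    have dx := hd _ mx
    have dy := hd _ my
    simp only [partialVec_self, partialVec_of_ne hxy, partialVec_of_ne hxy.symm, one_smul,
      zero_smul, add_zero, zero_add] at dx dy
    -- M contains B and C as derivatives, and Z[j+1]; hence also A, hence the whole frame of D^j
    -- modulo level j+1.
    let M : Submodule ℝ (EKRSpace r) := (vertical r (j + 1)).map
      (fderiv ℝ (ekrField r w (j + 1)) q : EKRSpace r →ₗ[ℝ] EKRSpace r) ⊔ ekrFlag r w (j + 1) q
    have hB : B q ∈ M := Submodule.mem_sup_left ⟨_, mx, dx⟩
    have hC : C q ∈ M := Submodule.mem_sup_left ⟨_, my, dy⟩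
    have hA : A q ∈ M := by
      have : A q = ekrField r w (j + 1) q - q (xIdx r (j + 1)) • B q
          - q (yIdx r (j + 1)) • C q := by rw [hZ]; abel
      rw [this]
      exact sub_mem (sub_mem (Submodule.mem_sup_right (ekrField_mem_ekrFlag hj q))
        (Submodule.smul_mem _ _ hB)) (Submodule.smul_mem _ _ hC)
    have key2 : ∀ f ∈ ({ekrField r w j, fun _ => partialVec (xIdx r j),
        fun _ => partialVec (yIdx r j)} : Set (EKRSpace r → EKRSpace r)), f q ∈ M := by
      rw [← hS]
      rintro f (rfl | rfl | rfl)
      exacts [hA, hB, hC]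
    have hle : ekrFlag r w j q ≤ M := by
      intro u hu
      have hu' := mem_ekrFlag_iff_sub_mem.1 hu
      set u' := u - u (pivot r w j) • ekrField r w j q with hu'_def
      have hxy := xIdx_ne_yIdx hj' hj'
      have h3 : u' - u' (xIdx r j) • partialVec (xIdx r j)
          - u' (yIdx r j) • partialVec (yIdx r j) ∈ vertical r (j + 1) := by
        refine (mem_vertical_succ hj').2 ⟨?_, ?_, ?_⟩
        · exact sub_mem (sub_mem hu' (Submodule.smul_mem _ _
            (partialVec_mem_vertical (by rw [xIdx_val hj'])))) (Submodule.smul_mem _ _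
            (partialVec_mem_vertical (by rw [yIdx_val hj']; omega)))
        · simp [partialVec_self, partialVec_of_ne hxy]
        · simp [partialVec_self, partialVec_of_ne hxy.symm]
      have h4 : u = (u' - u' (xIdx r j) • partialVec (xIdx r j)
          - u' (yIdx r j) • partialVec (yIdx r j)) + u (pivot r w j) • ekrField r w j q
          + u' (xIdx r j) • partialVec (xIdx r j) + u' (yIdx r j) • partialVec (yIdx r j) := by
        rw [hu'_def]; abel
      rw [h4]
      exact add_mem (add_mem (add_mem (Submodule.mem_sup_right (vertical_le_ekrFlag hj q h3))
        (Submodule.smul_mem _ _ (key2 _ (by simp))))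
        (Submodule.smul_mem _ _ (key2 (fun _ => partialVec (xIdx r j)) (by simp))))
        (Submodule.smul_mem _ _ (key2 (fun _ => partialVec (yIdx r j)) (by simp)))
    intro u hu
    obtain ⟨m, ⟨l, hl, rfl⟩, d, hd, hmd⟩ := Submodule.mem_sup.1 (hle hu)
    refine ⟨l, hl, ?_⟩
    rw [← hmd]
    simpa using hd

end Fields

/-! ### Brackets modulo D^j, the derived flag, Cauchy characteristics and the crossing condition. -/

section Calculus

variable {r : ℕ} {w : List ℕ}

theorem fderiv_ekrField_mem {j : ℕ} (hj : j + 1 ≤ r) (q : EKRSpace r) {v : EKRSpace r}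
    (hv : v ∈ vertical r (j + 1)) : fderiv ℝ (ekrField r w (j + 1)) q v ∈ ekrFlag r w j q :=
  (fderiv_ekrField_succ_mem hj q hv).1

theorem mem_vertical_of_fderiv_ekrField_mem {j : ℕ} (hj : j + 1 ≤ r) {q v : EKRSpace r}
    (hv : v ∈ vertical r (j + 1))
    (h : fderiv ℝ (ekrField r w (j + 1)) q v ∈ ekrFlag r w (j + 1) q) :
    v ∈ vertical r (j + 2) :=
  (fderiv_ekrField_succ_mem hj q hv).2.1 h

theorem exists_sub_fderiv_ekrField_mem {j : ℕ} (hj : j + 1 ≤ r) {q u : EKRSpace r}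
    (hu : u ∈ ekrFlag r w j q) : ∃ l ∈ vertical r (j + 1),
      u - fderiv ℝ (ekrField r w (j + 1)) q l ∈ ekrFlag r w (j + 1) q :=
  (fderiv_ekrField_succ_mem hj q (zero_mem _)).2.2 u hu

theorem fderiv_apply_coord {f : EKRSpace r → EKRSpace r} {q : EKRSpace r}
    (hf : DifferentiableAt ℝ f q) (k : Fin (2 * r + 3)) (v : EKRSpace r) :
    fderiv ℝ (fun q => f q k) q v = fderiv ℝ f q v k := by
  have := (hasFDerivAt_pi'.1 hf.hasFDerivAt k).fderiv
  rw [this]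
  rfl

theorem fderiv_ekrField_pivot {j : ℕ} (hj : j ≤ r) (q v : EKRSpace r) :
    fderiv ℝ (ekrField r w j) q v (pivot r w j) = 0 := by
  rw [← fderiv_apply_coord (differentiable_ekrField j q)]
  have : (fun q => ekrField r w j q (pivot r w j)) = fun _ => 1 :=
    funext fun q => ekrField_pivot hj q
  simp [this]

/-- The derivative of a section of `D^j` along a map `ψ`. -/
theorem fderiv_section_along_sub_mem {j : ℕ} (hj : j ≤ r) {ψ ξ : EKRSpace r → EKRSpace r}
    {q : EKRSpace r} (hψ : DifferentiableAt ℝ ψ q) (hξ : DifferentiableAt ℝ ξ q)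
    (hmem : ∀ᶠ q' in 𝓝 q, ξ q' ∈ ekrFlag r w j (ψ q')) (v : EKRSpace r) :
    fderiv ℝ ξ q v - ξ q (pivot r w j) • fderiv ℝ (ekrField r w j) (ψ q) (fderiv ℝ ψ q v)
      ∈ ekrFlag r w j (ψ q) := by
  intro k hk
  have hZ : DifferentiableAt ℝ (ekrField r w j ∘ ψ) q :=
    (differentiable_ekrField j (ψ q)).comp q hψ
  have e1 : (fun q' => ξ q' k) =ᶠ[𝓝 q]
      fun q' => ξ q' (pivot r w j) * (ekrField r w j ∘ ψ) q' k :=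
    -- Leibniz rule for ξ_k = ξ_pivot · Z_k ∘ ψ: the term differentiating ξ_pivot is a multiple of
    -- Z[j], and the other one is the subtracted term.
    hmem.mono fun q' h => h k hk
  have hp : DifferentiableAt ℝ (fun q' => ξ q' (pivot r w j)) q :=
    (differentiableAt_pi.1 hξ) _
  have hk' : DifferentiableAt ℝ (fun q' => (ekrField r w j ∘ ψ) q' k) q :=
    (differentiableAt_pi.1 hZ) _
  have e2 := congrArg (fun L => L v) (e1.fderiv_eq.trans (fderiv_fun_mul hp hk'))
  simp only [add_apply, smul_apply] at e2
  rw [fderiv_apply_coord hξ, fderiv_apply_coord hξ, fderiv_apply_coord hZ,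
    fderiv_comp q (differentiable_ekrField j (ψ q)) hψ] at e2
  simp only [Pi.sub_apply, Pi.smul_apply, fderiv_ekrField_pivot hj, e2, smul_eq_mul,
    Function.comp_apply, ContinuousLinearMap.comp_apply]
  ring

theorem fderiv_section_sub_mem {j : ℕ} (hj : j ≤ r) {X : EKRSpace r → EKRSpace r}
    {q : EKRSpace r} (hX : DifferentiableAt ℝ X q)
    (hmem : ∀ᶠ q' in 𝓝 q, X q' ∈ ekrFlag r w j q') (v : EKRSpace r) :
    fderiv ℝ X q v - X q (pivot r w j) • fderiv ℝ (ekrField r w j) q v ∈ ekrFlag r w j q := by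
  simpa using fderiv_section_along_sub_mem hj (ψ := fun q => q) differentiableAt_id hX hmem v

theorem pivot_smul_sub_mem_vertical {j : ℕ} {q u v : EKRSpace r}
    (hu : u ∈ ekrFlag r w j q) (hv : v ∈ ekrFlag r w j q) :
    v (pivot r w j) • u - u (pivot r w j) • v ∈ vertical r j := by
  intro k hk
  simp only [Pi.sub_apply, Pi.smul_apply, smul_eq_mul, hu k hk, hv k hk]
  ring

/-- Modulo D^j the derivative of a section is its pivot component times the derivative of Z[j].
Antisymmetrising leaves a tensorial expression: Z[j] is differentiated along a combination whose
pivot component cancels, so the direction is vertical. -/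
theorem lieBracket_section_sub_mem {j : ℕ} (hj : j ≤ r) {X Y : EKRSpace r → EKRSpace r}
    {q : EKRSpace r} (hX : DifferentiableAt ℝ X q) (hY : DifferentiableAt ℝ Y q)
    (hX' : ∀ᶠ q' in 𝓝 q, X q' ∈ ekrFlag r w j q') (hY' : ∀ᶠ q' in 𝓝 q, Y q' ∈ ekrFlag r w j q') :
    VectorField.lieBracket ℝ X Y q - fderiv ℝ (ekrField r w j) q
      (Y q (pivot r w j) • X q - X q (pivot r w j) • Y q) ∈ ekrFlag r w j q := by
  have h1 := fderiv_section_sub_mem hj hY hY' (X q)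
  have h2 := fderiv_section_sub_mem hj hX hX' (Y q)
  have h3 := sub_mem h1 h2
  rw [VectorField.lieBracket_eq, map_sub, map_smul, map_smul]
  rwa [sub_sub_sub_comm] at h3

theorem lieBracket_section_mem {j : ℕ} (hj : j + 1 ≤ r) {X Y : EKRSpace r → EKRSpace r}
    {q : EKRSpace r} (hX : DifferentiableAt ℝ X q) (hY : DifferentiableAt ℝ Y q)
    (hX' : ∀ᶠ q' in 𝓝 q, X q' ∈ ekrFlag r w (j + 1) q')
    (hY' : ∀ᶠ q' in 𝓝 q, Y q' ∈ ekrFlag r w (j + 1) q') :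
    VectorField.lieBracket ℝ X Y q ∈ ekrFlag r w j q := by
  have h := ekrFlag_succ_le hj q (lieBracket_section_sub_mem hj hX hY hX' hY')
  have h' := fderiv_ekrField_mem hj q (w := w)
    (pivot_smul_sub_mem_vertical hX'.self_of_nhds hY'.self_of_nhds)
  simpa using add_mem h h'

/-- The section of `D^j` with the constant `Z[j]`-coordinate and the constant vertical part of a
vector in a fibre. -/
theorem exists_section {j : ℕ} (hj : j ≤ r) {q v : EKRSpace r} (hv : v ∈ ekrFlag r w j q) :
    ∃ X : EKRSpace r → EKRSpace r, ContDiff ℝ ∞ X ∧ (∀ q', X q' ∈ ekrFlag r w j q') ∧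
      X q = v := by
  refine ⟨fun q' => v (pivot r w j) • ekrField r w j q'
    + (v - v (pivot r w j) • ekrField r w j q), ?_, fun q' => ?_, by simp⟩
  · exact ((contDiff_ekrField r w j).const_smul _).add contDiff_const
  · exact add_mem (Submodule.smul_mem _ _ (ekrField_mem_ekrFlag hj q'))
      (vertical_le_ekrFlag hj q' (mem_ekrFlag_iff_sub_mem.1 hv))

theorem lieBracket_const_left (l : EKRSpace r) (X : EKRSpace r → EKRSpace r) :
    VectorField.lieBracket ℝ (fun _ => l) X = fun q => fderiv ℝ X q l := by
  funext q
  simp [VectorField.lieBracket_eq]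

theorem IsSection.differentiableAt {E : Type*} [NormedAddCommGroup E] [NormedSpace ℝ E]
    {D : E → Submodule ℝ E} {U : Set E} {X : E → E} (h : IsSection D U X) (hU : IsOpen U) {q : E}
    (hq : q ∈ U) : DifferentiableAt ℝ X q :=
  (h.1.contDiffAt (hU.mem_nhds hq)).differentiableAt (by simp)

theorem IsSection.eventually_mem {E : Type*} [NormedAddCommGroup E] [NormedSpace ℝ E]
    {D : E → Submodule ℝ E} {U : Set E} {X : E → E} (h : IsSection D U X) (hU : IsOpen U) {q : E}
    (hq : q ∈ U) : ∀ᶠ q' in 𝓝 q, X q' ∈ D q' :=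
  Filter.eventually_of_mem (hU.mem_nhds hq) h.2

theorem contDiffOn_lieBracket {E : Type*} [NormedAddCommGroup E] [NormedSpace ℝ E]
    {U : Set E} (hU : IsOpen U) {X Y : E → E} (hX : ContDiffOn ℝ ∞ X U)
    (hY : ContDiffOn ℝ ∞ Y U) : ContDiffOn ℝ ∞ (VectorField.lieBracket ℝ X Y) U := fun _ hq =>
  ((hX.contDiffAt (hU.mem_nhds hq)).lieBracket_vectorField (m := ∞)
    (hY.contDiffAt (hU.mem_nhds hq)) (by simp)).contDiffWithinAt

/-- Brackets stay in D^j because vertical derivatives of Z[j+1] do; conversely, those derivatives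
are brackets of constant vertical fields with Z[j+1] and exhaust D^j modulo D^{j+1}. -/
theorem lieSquare_ekrFlag {j : ℕ} (hj : j + 1 ≤ r) :
    lieSquare (ekrFlag r w (j + 1)) = ekrFlag r w j := by
  funext q
  apply le_antisymm
  · refine Submodule.span_le.2 ?_
    rintro v ⟨U, hU, hq, X, hX | ⟨X, Y, hX, hY, rfl⟩, rfl⟩
    · exact ekrFlag_succ_le hj q (hX.2 q hq)
    · exact lieBracket_section_mem hj (hX.differentiableAt hU hq)
        (IsSection.differentiableAt hY hU hq)
        (hX.eventually_mem hU hq) (IsSection.eventually_mem hY hU hq)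
  · intro u hu
    obtain ⟨l, hl, h⟩ := exists_sub_fderiv_ekrField_mem hj hu
    rw [← sub_add_cancel u (fderiv ℝ (ekrField r w (j + 1)) q l)]
    refine add_mem (Submodule.subset_span ?_) (Submodule.subset_span ?_)
    · obtain ⟨X, hX, hX', hXq⟩ := exists_section hj h
      exact ⟨Set.univ, isOpen_univ, trivial, X, Or.inl ⟨hX.contDiffOn, fun q' _ => hX' q'⟩, hXq⟩
    · refine ⟨Set.univ, isOpen_univ, trivial, _, Or.inr ⟨fun _ => l, ekrField r w (j + 1),
        ⟨contDiffOn_const, fun q' _ => vertical_le_ekrFlag hj q' hl⟩,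
        ⟨(contDiff_ekrField r w _).contDiffOn, fun q' _ => ekrField_mem_ekrFlag hj q'⟩, rfl⟩, ?_⟩
      rw [lieBracket_const_left]

theorem ekrDistribution_eq (r : ℕ) (w : List ℕ) : ekrDistribution r w = ekrFlag r w r := by
  funext q
  have hxv := xIdx_val (le_refl r)
  have hyv := yIdx_val (le_refl r)
  apply le_antisymm
  · refine Submodule.span_le.2 ?_
    rintro v (rfl | rfl | rfl)
    · exact ekrField_mem_ekrFlag le_rfl q
    · exact vertical_le_ekrFlag le_rfl q (partialVec_mem_vertical (by omega))
    · exact vertical_le_ekrFlag le_rfl q (partialVec_mem_vertical (by omega))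
  · rw [ekrFlag_eq_sup le_rfl]
    refine sup_le (fun v hv => ?_) (Submodule.span_mono (by simp))
    have : v = v (xIdx r r) • partialVec (xIdx r r) + v (yIdx r r) • partialVec (yIdx r r) := by
      rw [← sub_eq_zero]
      have hxy := xIdx_ne_yIdx (le_refl r) (le_refl r)
      have h : v - (v (xIdx r r) • partialVec (xIdx r r)
          + v (yIdx r r) • partialVec (yIdx r r)) ∈ vertical r (r + 1) := by
        refine (mem_vertical_succ le_rfl).2 ⟨sub_mem hv (add_mem
          (Submodule.smul_mem _ _ (partialVec_mem_vertical (by omega)))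
          (Submodule.smul_mem _ _ (partialVec_mem_vertical (by omega)))), ?_, ?_⟩
        · simp [partialVec_self, partialVec_of_ne hxy]
        · simp [partialVec_self, partialVec_of_ne hxy.symm]
      funext k
      exact h k (by have := k.isLt; omega)
    rw [this]
    exact add_mem (Submodule.smul_mem _ _ (Submodule.subset_span (by simp)))
      (Submodule.smul_mem _ _ (Submodule.subset_span (by simp)))

theorem flagMember_ekrDistribution {j : ℕ} (hj : j ≤ r) :
    flagMember r (ekrDistribution r w) j = ekrFlag r w j := by
  have : ∀ k, k ≤ r → derivedFlag (ekrDistribution r w) k = ekrFlag r w (r - k) := by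
    intro k
    induction k with
    | zero => intro _; exact ekrDistribution_eq r w
    | succ k ih =>
      intro hk
      rw [derivedFlag, ih (by omega), show r - k = (r - (k + 1)) + 1 by omega,
        lieSquare_ekrFlag (by omega)]
  rw [flagMember, this _ (by omega), Nat.sub_sub_self hj]

theorem isSection_lieBracket_vertical {j : ℕ} {V : Set (EKRSpace r)} (hV : IsOpen V)
    {X Y : EKRSpace r → EKRSpace r} (hX : IsSection (fun _ => vertical r j) V X)
    (hY : IsSection (fun _ => vertical r j) V Y) :
    IsSection (fun _ => vertical r j) V (VectorField.lieBracket ℝ X Y) := by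
  have key : ∀ X : EKRSpace r → EKRSpace r, IsSection (fun _ => vertical r j) V X →
      ∀ q ∈ V, ∀ v, fderiv ℝ X q v ∈ vertical r j := by
    intro X hX q hq v k hk
    rw [← fderiv_apply_coord (hX.differentiableAt hV hq)]
    have : (fun q => X q k) =ᶠ[𝓝 q] fun _ => 0 :=
      (hX.eventually_mem hV hq).mono fun q' h => h k hk
    rw [this.fderiv_eq]
    simp
  refine ⟨contDiffOn_lieBracket hV hX.1 hY.1, fun q hq => ?_⟩
  rw [VectorField.lieBracket_eq]
  exact sub_mem (key Y hY q hq _) (key X hX q hq _)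

/-- A characteristic field X must pair trivially with every section under the bracket modulo
D^{j+1}. Pairing with ∂_{x^{j+1}} kills its Z-component; pairing with Z[j+1] then pushes X into the
kernel, `vertical r (j + 2)`. Conversely, constant fields in that kernel leave Z[j+1] unchanged. -/
theorem cauchyChar_ekrFlag {j : ℕ} (hj : j + 1 ≤ r) :
    cauchyChar (ekrFlag r w (j + 1)) = fun _ => vertical r (j + 2) := by
  funext q
  apply le_antisymm
  · refine Submodule.span_le.2 ?_
    rintro v ⟨U, hU, hq, X, hX, hP, rfl⟩
    have key : ∀ W : EKRSpace r → EKRSpace r, ContDiff ℝ ∞ W →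
        (∀ q', W q' ∈ ekrFlag r w (j + 1) q') →
        W q (pivot r w (j + 1)) • X q - X q (pivot r w (j + 1)) • W q ∈ vertical r (j + 2) := by
      intro W hW hW'
      have h1 := (hP U hU subset_rfl W ⟨hW.contDiffOn, fun q' _ => hW' q'⟩).2 q hq
      have h2 := lieBracket_section_sub_mem hj (hX.differentiableAt hU hq)
        (hW.differentiable (by simp) q) (hX.eventually_mem hU hq) (Filter.Eventually.of_forall hW')
      refine mem_vertical_of_fderiv_ekrField_mem (w := w) (q := q) hj
        (pivot_smul_sub_mem_vertical (hX.2 q hq) (hW' q)) ?_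
      simpa using sub_mem h1 h2
    have hxm : (partialVec (xIdx r (j + 1)) : EKRSpace r) ∈ vertical r (j + 1) :=
      partialVec_mem_vertical (by rw [xIdx_val hj])
    have h0 : X q (pivot r w (j + 1)) = 0 := by
      have h1 := key (fun _ => partialVec (xIdx r (j + 1))) contDiff_const
        (fun q' => vertical_le_ekrFlag hj q' hxm)
      have h2 := h1 (xIdx r (j + 1)) (by rw [xIdx_val hj]; omega)
      simpa [hxm _ (pivot_val_lt (w := w) hj), partialVec_self] using h2
    have h3 := key (ekrField r w (j + 1)) (contDiff_ekrField r w _)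
      (fun q' => ekrField_mem_ekrFlag hj q')
    simpa [h0, ekrField_pivot hj] using h3
  · intro v hv
    have hv' := vertical_antitone (Nat.le_succ (j + 1)) hv
    refine Submodule.subset_span ⟨Set.univ, isOpen_univ, trivial, fun _ => v,
      ⟨contDiffOn_const, fun q' _ => vertical_le_ekrFlag hj q' hv'⟩, ?_, rfl⟩
    intro V hV _ X hX
    refine ⟨contDiffOn_lieBracket hV contDiffOn_const hX.1, fun q' hq' => ?_⟩
    have h := fderiv_section_sub_mem hj (hX.differentiableAt hV hq') (hX.eventually_mem hV hq') v
    rw [fderiv_ekrField_eq_zero hj q' hv, smul_zero, sub_zero] at h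
    rwa [lieBracket_const_left]

theorem isDistribution_vertical {j : ℕ} (hj : j ≤ r + 1) (U : Set (EKRSpace r)) (hU : IsOpen U) :
    IsDistribution (fun _ => vertical r j) (2 * (r + 1 - j)) U := fun _ hq =>
  ⟨finrank_vertical hj, fun v hv => ⟨U, hU, hq, subset_rfl, fun _ => v,
    ⟨contDiffOn_const, fun _ _ => hv⟩, rfl⟩⟩

theorem isDistribution_ekrFlag {j : ℕ} (hj : j ≤ r) (U : Set (EKRSpace r)) (hU : IsOpen U) :
    IsDistribution (ekrFlag r w j) (2 * (r - j) + 3) U := fun q hq =>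
  ⟨finrank_ekrFlag hj q, fun _ hv => by
    obtain ⟨X, hX, hX', e⟩ := exists_section hj hv
    exact ⟨U, hU, hq, subset_rfl, X, ⟨hX.contDiffOn, fun q' _ => hX' q'⟩, e⟩⟩

theorem cauchyChar_flagMember {j : ℕ} (h1 : 1 ≤ j) (hj : j ≤ r) :
    cauchyChar (flagMember r (ekrDistribution r w) j) = fun _ => vertical r (j + 1) := by
  obtain ⟨i, rfl⟩ : ∃ i, j = i + 1 := ⟨j - 1, by omega⟩
  rw [flagMember_ekrDistribution hj, cauchyChar_ekrFlag hj]

/-- The distribution of any word of length `r ≥ 1` generates a special 2-flag, with covariant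
subdistribution the vertical distribution of level one. -/
theorem isSpecialTwoFlag_ekrDistribution (hr : 1 ≤ r) (w : List ℕ) :
    IsSpecialTwoFlag r (ekrDistribution r w) (fun _ => vertical r 1) Set.univ where
  one_le := hr
  finrank_eq := by simp
  flag_zero q _ := by rw [flagMember_ekrDistribution (Nat.zero_le r), ekrFlag_zero]
  flag_rank j _ hj := by
    rw [flagMember_ekrDistribution hj]
    exact isDistribution_ekrFlag hj _ isOpen_univ
  cov_rank := isDistribution_vertical (j := 1) (by omega) _ isOpen_univ
  cov_le q _ := by
    rw [flagMember_ekrDistribution hr]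
    exact vertical_le_ekrFlag hr q
  cov_involutive V hV _ X Y hX hY := isSection_lieBracket_vertical hV hX hY
  cauchy_rank j h1 hj := by
    rw [cauchyChar_flagMember h1 hj.le]
    have := isDistribution_vertical (r := r) (j := j + 1) (by omega) _ isOpen_univ
    rwa [show r + 1 - (j + 1) = r - j by omega] at this
  cauchy_le j h1 hj q _ := by
    rw [cauchyChar_flagMember h1 hj.le, flagMember_ekrDistribution (by omega)]
    exact vertical_le_ekrFlag (by omega) q
  cauchy_involutive j h1 hj V hV _ X Y hX hY := by
    rw [cauchyChar_flagMember h1 hj.le] at hX hY ⊢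
    exact isSection_lieBracket_vertical hV hX hY
  cauchy_le_cov h2 q _ := by
    rw [cauchyChar_flagMember le_rfl hr]
    exact vertical_antitone (by omega)
  cauchy_antitone j h1 hj q _ := by
    rw [cauchyChar_flagMember h1 hj.le, cauchyChar_flagMember (by omega) (by omega)]
    exact vertical_antitone (by omega)
  cauchy_last q _ := by
    have : flagMember r (ekrDistribution r w) r = ekrDistribution r w := by
      simp [flagMember, derivedFlag]
    rw [← this, cauchyChar_flagMember hr le_rfl, eq_bot_iff]
    intro v hv
    rw [Submodule.mem_bot]
    funext k
    exact hv k (by have := k.isLt; omega)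

theorem sandwichSpace_ekrDistribution {j : ℕ} (h2 : 2 ≤ j) (hj : j ≤ r) :
    sandwichSpace r (ekrDistribution r w) (fun _ => vertical r 1) j
      = fun _ => vertical r (j - 1) := by
  unfold sandwichSpace
  split_ifs with h
  · rw [h]
  · rw [cauchyChar_flagMember (by omega) (by omega), show j - 2 + 1 = j - 1 by omega]

/-- The vertical part of D^{j+1} always lies in the sandwich space `vertical r j`, so only Z[j+1]
decides. -/
theorem isCrossed_ekrDistribution_iff {j : ℕ} (h1 : 1 ≤ j) (hj : j + 1 ≤ r) {p : EKRSpace r} :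
    IsCrossed r (ekrDistribution r w) (fun _ => vertical r 1) p (j + 1) ↔
      ekrField r w (j + 1) p ∈ vertical r j := by
  rw [IsCrossed, flagMember_ekrDistribution hj, sandwichSpace_ekrDistribution (by omega) hj,
    Nat.add_sub_cancel, ekrFlag_eq_sup hj, sup_le_iff, Submodule.span_singleton_le_iff_mem]
  exact ⟨fun h => h.2.2, fun h => ⟨by omega, vertical_antitone (Nat.le_succ j), h⟩⟩

theorem not_isCrossed_of_one {j : ℕ} (h1 : 1 ≤ j) (hj : j + 1 ≤ r) {p : EKRSpace r}
    (hw : w.getD j 1 = 1) :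
    ¬ IsCrossed r (ekrDistribution r w) (fun _ => vertical r 1) p (j + 1) := by
  rw [isCrossed_ekrDistribution_iff h1 hj, ekrField_succ_one (by omega) (by omega)]
  intro h
  have hjr : j ≤ r := by omega
  have h' := h _ (pivot_val_lt (w := w) hjr)
  obtain ⟨hx, hy⟩ := pivot_ne (w := w) hjr
  simp [ekrField_pivot hjr, partialVec_of_ne hx, partialVec_of_ne hy] at h'

theorem isCrossed_of_two {j : ℕ} (h1 : 1 ≤ j) (hj : j + 1 ≤ r) {p : EKRSpace r}
    (hw : w.getD j 1 = 2) (hp : p (xIdx r (j + 1)) = 0) :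
    IsCrossed r (ekrDistribution r w) (fun _ => vertical r 1) p (j + 1) := by
  rw [isCrossed_ekrDistribution_iff h1 hj, ekrField_succ_two hw, hp, zero_smul, zero_add]
  have hjr : j ≤ r := by omega
  exact add_mem (partialVec_mem_vertical (by rw [xIdx_val hjr]))
    (Submodule.smul_mem _ _ (partialVec_mem_vertical (by rw [yIdx_val hjr]; omega)))

end Calculus

/-! ### Excluding the letter 3 for consecutive letters 2.1.2. -/

section SmallFlag

variable {r : ℕ} {w : List ℕ}

theorem fderiv_ekrField_succ_one {j : ℕ} (h : w.getD j 1 = 1) (q v : EKRSpace r) :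
    fderiv ℝ (ekrField r w (j + 1)) q v = fderiv ℝ (ekrField r w j) q v
      + v (xIdx r (j + 1)) • partialVec (xIdx r j)
      + v (yIdx r (j + 1)) • partialVec (yIdx r j) := by
  have e : ekrField r w (j + 1) = _ :=
    funext fun q => ekrField_succ_one (r := r) (w := w) (j := j) (by omega) (by omega) q
  rw [e, fderiv_affine_frame (differentiable_ekrField j q) (by simp) (by simp)]
  simp

theorem fderiv_ekrField_succ_two {j : ℕ} (h : w.getD j 1 = 2) (q v : EKRSpace r) :
    fderiv ℝ (ekrField r w (j + 1)) q v = q (xIdx r (j + 1)) • fderiv ℝ (ekrField r w j) q v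
      + v (xIdx r (j + 1)) • ekrField r w j q
      + v (yIdx r (j + 1)) • partialVec (yIdx r j) := by
  have e : ekrField r w (j + 1) = fun q => partialVec (xIdx r j)
      + q (xIdx r (j + 1)) • ekrField r w j q + q (yIdx r (j + 1)) • partialVec (yIdx r j) :=
    funext fun q => by rw [ekrField_succ_two h, add_comm (partialVec _)]
  rw [e, fderiv_affine_frame (by simp) (differentiable_ekrField j q) (by simp)]
  simp

/-- For the letters `2.1.2` at the positions `j + 1, j + 2, j + 3`, the last of them is not
specified to `3`. -/
theorem not_smallFlag_le_vertical {j : ℕ} (hj : j + 3 ≤ r) (h1 : w.getD j 1 = 2)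
    (h2 : w.getD (j + 1) 1 = 1) (h3 : w.getD (j + 2) 1 = 2) (p : EKRSpace r) :
    ¬ smallFlag (ekrFlag r w (j + 3)) 5 p ≤ vertical r j := by
  have x1 := xIdx_val (r := r) (j := j + 1) (by omega)
  have y1 := yIdx_val (r := r) (j := j + 1) (by omega)
  have x2 := xIdx_val (r := r) (j := j + 2) (by omega)
  have y2 := yIdx_val (r := r) (j := j + 2) (by omega)
  have x3 := xIdx_val hj
  have y3 := yIdx_val hj
  have hxy1 := xIdx_ne_yIdx (r := r) (i := j + 1) (j := j + 1) (by omega) (by omega)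
  have hxy3 := xIdx_ne_yIdx hj hj
  let Z := ekrField r w (j + 3)
  -- The bracket [e, [Z, [Z, [e, Z]]]] lies in V_5. Its stages are Z[j+2], then u, then a field with
  -- the factor x^{j+3}, which may vanish at p; the last bracket with e removes that factor and
  -- uncovers Z[j], whose pivot component is 1.
  let e : EKRSpace r := partialVec (xIdx r (j + 3))
  let u : EKRSpace r → EKRSpace r := fun q =>
    partialVec (xIdx r (j + 1)) + q (yIdx r (j + 3)) • partialVec (yIdx r (j + 1))
  have he : e ∈ vertical r (j + 3) := partialVec_mem_vertical (by omega)
  have hu : ∀ q, u q ∈ vertical r (j + 1) := fun q =>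
    add_mem (partialVec_mem_vertical (by omega))
      (Submodule.smul_mem _ _ (partialVec_mem_vertical (by omega)))
  have hdu : ∀ q v, fderiv ℝ u q v = v (yIdx r (j + 3)) • partialVec (yIdx r (j + 1)) := by
    intro q v
    have := ((ContinuousLinearMap.proj (R := ℝ) (φ := fun _ : Fin (2 * r + 3) => ℝ)
      (yIdx r (j + 3))).hasFDerivAt (x := q)).smul_const
        (partialVec (yIdx r (j + 1)) : EKRSpace r)
    have := (this.const_add (partialVec (xIdx r (j + 1)) : EKRSpace r)).fderiv
    exact congrArg (fun L => L v) this
  have b2 : VectorField.lieBracket ℝ (fun _ => e) Z = ekrField r w (j + 2) := by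
    rw [lieBracket_const_left]
    funext q
    rw [fderiv_ekrField_succ_two h3, fderiv_ekrField_eq_zero (by omega) q he]
    simp [e, partialVec_self, partialVec_of_ne hxy3.symm]
  have b3 : VectorField.lieBracket ℝ Z (ekrField r w (j + 2)) = u := by
    funext q
    have zx : ekrField r w (j + 2) q (xIdx r (j + 3)) = 0 :=
      ekrField_apply_eq_zero (by omega) q (by omega)
    have zy : ekrField r w (j + 2) q (yIdx r (j + 3)) = 0 :=
      ekrField_apply_eq_zero (by omega) q (by omega)
    have hv : (partialVec (xIdx r (j + 2)) : EKRSpace r)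
        + q (yIdx r (j + 3)) • partialVec (yIdx r (j + 2)) ∈ vertical r (j + 2) :=
      add_mem (partialVec_mem_vertical (by omega))
        (Submodule.smul_mem _ _ (partialVec_mem_vertical (by omega)))
    have hxy2 := xIdx_ne_yIdx (r := r) (i := j + 2) (j := j + 2) (by omega) (by omega)
    rw [VectorField.lieBracket_eq]
    simp only [Z]
    rw [fderiv_ekrField_succ_two h3 q (ekrField r w (j + 2) q), zx, zy, ekrField_succ_two h3,
      add_assoc, map_add, map_smul,
      fderiv_ekrField_succ_one (j := j + 1) h2 q (partialVec (xIdx r (j + 2)) + _),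
      fderiv_ekrField_eq_zero (by omega) q hv]
    simp [u, partialVec_self, partialVec_of_ne hxy2, partialVec_of_ne hxy2.symm]
  have b4 : VectorField.lieBracket ℝ Z u = fun q => (-q (xIdx r (j + 3))) •
      (ekrField r w j q + q (yIdx r (j + 3)) • partialVec (yIdx r j)) := by
    funext q
    have zy : Z q (yIdx r (j + 3)) = 0 := ekrField_apply_eq_zero (by omega) q (by omega)
    have x2' : (xIdx r (j + 1 + 1)).val = 2 * (j + 2) + 1 := x2
    have y2' : (yIdx r (j + 1 + 1)).val = 2 * (j + 2) + 2 := y2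
    have x3' : (xIdx r (j + 2 + 1)).val = 2 * (j + 3) + 1 := x3
    have y3' : (yIdx r (j + 2 + 1)).val = 2 * (j + 3) + 2 := y3
    have ux : ∀ i, 2 * j + 5 ≤ i.val → u q i = 0 := fun i hi => by
      simp only [u, Pi.add_apply, Pi.smul_apply]
      rw [partialVec_of_ne (fun h => by rw [h] at hi; omega),
        partialVec_of_ne (fun h => by rw [h] at hi; omega)]
      simp
    rw [VectorField.lieBracket_eq]
    simp only [hdu, zy, Z]
    rw [fderiv_ekrField_succ_two h3, fderiv_ekrField_succ_one h2, fderiv_ekrField_succ_two h1,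
      fderiv_ekrField_eq_zero (by omega) q (hu q), ux (xIdx r (j + 1 + 1)) (by omega),
      ux (yIdx r (j + 1 + 1)) (by omega), ux (xIdx r (j + 2 + 1)) (by omega),
      ux (yIdx r (j + 2 + 1)) (by omega)]
    simp [u, partialVec_self, partialVec_of_ne hxy1, partialVec_of_ne hxy1.symm]
    exact add_comm _ _
  have b5 : VectorField.lieBracket ℝ (fun _ => e) (VectorField.lieBracket ℝ Z u) p =
      -(ekrField r w j p + p (yIdx r (j + 3)) • partialVec (yIdx r j)) := by
    have hc : ∀ k : Fin (2 * r + 3), DifferentiableAt ℝ (fun q : EKRSpace r => q k) p :=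
      fun k => differentiableAt_apply k p
    have hf := (hc (xIdx r (j + 3))).neg
    have hg : DifferentiableAt ℝ
        (fun q => ekrField r w j q + q (yIdx r (j + 3)) • partialVec (yIdx r j)) p :=
      (differentiable_ekrField j p).add ((hc _).smul_const _)
    have hg' : fderiv ℝ
        (fun q => ekrField r w j q + q (yIdx r (j + 3)) • partialVec (yIdx r j)) p e = 0 := by
      have := ((differentiable_ekrField (w := w) j p).hasFDerivAt.add ((hc
        (yIdx r (j + 3))).hasFDerivAt.smul_const (partialVec (yIdx r j) : EKRSpace r))).fderiv
      have := congrArg (fun L => L e) this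
      simp only [add_apply, ContinuousLinearMap.smulRight_apply, fderiv_coord,
        fderiv_ekrField_eq_zero (w := w) (j := j) (by omega) p
          (vertical_antitone (by omega) he)] at this
      refine Eq.trans this ?_
      simp [e, partialVec_of_ne hxy3.symm]
    rw [b4, lieBracket_const_left]
    have := congrArg (fun L => L e) (hf.hasFDerivAt.smul hg.hasFDerivAt).fderiv
    simp only [add_apply, smul_apply, ContinuousLinearMap.smulRight_apply, hg', fderiv_neg,
      neg_apply, fderiv_coord] at this
    refine Eq.trans this ?_
    simp [e, partialVec_self]
    exact add_comm _ _
  have hZs : IsSection (ekrFlag r w (j + 3)) Set.univ Z :=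
    ⟨(contDiff_ekrField r w _).contDiffOn, fun q _ => ekrField_mem_ekrFlag hj q⟩
  have hes : IsSection (ekrFlag r w (j + 3)) Set.univ fun _ => e :=
    ⟨contDiffOn_const, fun q _ => vertical_le_ekrFlag hj q he⟩
  have hmem : VectorField.lieBracket ℝ (fun _ => e) (VectorField.lieBracket ℝ Z u) p ∈
      smallFlag (ekrFlag r w (j + 3)) 5 p := by
    refine Submodule.subset_span ⟨Set.univ, isOpen_univ, trivial, _, Or.inr ⟨_, _, hes,
      Or.inr ⟨_, _, hZs, Or.inr ⟨_, _, hZs, Or.inr ⟨_, _, hes, hZs, rfl⟩, rfl⟩, rfl⟩, rfl⟩, ?_⟩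
    rw [b2, b3]
  intro hle
  have h := hle hmem _ (pivot_val_lt (w := w) (j := j) (by omega))
  rw [b5] at h
  simp [ekrField_pivot (w := w) (j := j) (by omega) p,
    partialVec_of_ne (pivot_ne (w := w) (j := j) (r := r) (by omega)).2] at h

end SmallFlag

/-! ### The singularity class at P_c. -/

section Class

theorem isCrossed_code7_iff (c : ℝ) {j : ℕ} (h1 : 1 ≤ j) (h7 : j ≤ 7) :
    IsCrossed 7 Delta7 (fun _ => vertical 7 1) (pointP c) j ↔ j = 2 ∨ j = 4 ∨ j = 6 := by
  have h0 : ∀ i, i = 2 ∨ i = 4 ∨ i = 6 → pointP c (xIdx 7 i) = 0 := by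
    rintro i (rfl | rfl | rfl) <;> simp [pointP, partialVec, xIdx]
  have cr : ∀ i, 1 ≤ i → i + 1 ≤ 7 → code7.getD i 1 = 2 → pointP c (xIdx 7 (i + 1)) = 0 →
    IsCrossed 7 Delta7 (fun _ => vertical 7 1) (pointP c) (i + 1) :=
    fun i h1 h2 h3 h4 => isCrossed_of_two h1 h2 h3 h4
  have nc : ∀ i, 1 ≤ i → i + 1 ≤ 7 → code7.getD i 1 = 1 →
    ¬ IsCrossed 7 Delta7 (fun _ => vertical 7 1) (pointP c) (i + 1) :=
    fun i h1 h2 h3 => not_isCrossed_of_one h1 h2 h3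
  interval_cases j
  · simp [IsCrossed]
  · simpa using cr 1 (by norm_num) (by norm_num) rfl (h0 2 (by simp))
  · simpa using nc 2 (by norm_num) (by norm_num) rfl
  · simpa using cr 3 (by norm_num) (by norm_num) rfl (h0 4 (by simp))
  · simpa using nc 4 (by norm_num) (by norm_num) rfl
  · simpa using cr 5 (by norm_num) (by norm_num) rfl (h0 6 (by simp))
  · simpa using nc 6 (by norm_num) (by norm_num) rfl

theorem not_isThree_code7 (c : ℝ) {s : ℕ} (hs : s = 2 ∨ s = 4 ∨ s = 6) :
    ¬ IsThree 7 Delta7 (fun _ => vertical 7 1) (pointP c) s := by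
  rintro ⟨t, hts, hct, hn, hle⟩
  have ht2 : 2 ≤ t := hct.1
  have ht := (isCrossed_code7_iff c (by omega) (by omega)).1 hct
  -- The pair (6, 2) is excluded because position 4, between them, is also crossed. So exactly one
  -- letter 1 separates s from t, and the small-flag member to test is V_5.
  have hst : s = t + 2 := by
    by_contra hne
    have h4 : s = 6 ∧ t = 2 := by omega
    exact hn 4 (by omega) (by omega) ((isCrossed_code7_iff c (by omega) (by omega)).2 (by simp))
  subst hst
  rw [show t + 2 - t - 1 = 1 by omega, Delta7, sandwichSpace_ekrDistribution ht2 (by omega),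
    flagMember_ekrDistribution (by omega)] at hle
  have ht' : t = 2 ∨ t = 4 := by omega
  rcases ht' with rfl | rfl
  · exact not_smallFlag_le_vertical (r := 7) (w := code7) (j := 1) (by norm_num) rfl rfl rfl _ hle
  · exact not_smallFlag_le_vertical (r := 7) (w := code7) (j := 3) (by norm_num) rfl rfl rfl _ hle

theorem hasSingularityClass_Delta7 (c : ℝ) :
    HasSingularityClass 7 Delta7 (pointP c) [1, 2, 1, 2, 1, 2, 1] := by
  refine ⟨Set.univ, fun _ => vertical 7 1, isOpen_univ, trivial,
    isSpecialTwoFlag_ekrDistribution (by norm_num) _, rfl, fun j h1 h7 => ?_⟩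
  unfold singularityLetter
  rw [isCrossed_code7_iff c h1 h7]
  by_cases hj : j = 2 ∨ j = 4 ∨ j = 6
  · rw [if_pos hj, if_neg (not_isThree_code7 c hj)]
    rcases hj with rfl | rfl | rfl <;> rfl
  · rw [if_neg hj]
    have : j = 1 ∨ j = 3 ∨ j = 5 ∨ j = 7 := by omega
    rcases this with rfl | rfl | rfl | rfl <;> rfl

end Class

/-! ### Diffeomorphisms preserving the distribution, and the factors a_j. -/

section Morphism

variable {r : ℕ} {w : List ℕ} {φ : EKRSpace r → EKRSpace r} {U : Set (EKRSpace r)}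

theorem differentiableAt_fderiv_apply (hU : IsOpen U) (hφ : ContDiffOn ℝ ∞ φ U)
    {X : EKRSpace r → EKRSpace r} {q : EKRSpace r} (hX : DifferentiableAt ℝ X q) (hq : q ∈ U) :
    DifferentiableAt ℝ (fun q => fderiv ℝ φ q (X q)) q :=
  (((hφ.contDiffAt (hU.mem_nhds hq)).fderiv_right (m := 1) (by norm_cast)).differentiableAt
    (by simp)).clm_apply hX

theorem fderiv_fderiv_apply_swap (hU : IsOpen U) (hφ : ContDiffOn ℝ ∞ φ U)
    {X Y : EKRSpace r → EKRSpace r} {q : EKRSpace r} (hq : q ∈ U) (hX : DifferentiableAt ℝ X q)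
    (hY : DifferentiableAt ℝ Y q) :
    fderiv ℝ φ q (VectorField.lieBracket ℝ X Y q) = fderiv ℝ (fun q => fderiv ℝ φ q (Y q)) q (X q)
      - fderiv ℝ (fun q => fderiv ℝ φ q (X q)) q (Y q) :=
  VectorField.fderiv_apply_lieBracket (hφ.contDiffAt (hU.mem_nhds hq)) (by simp; norm_cast) hY hX

/-- Naturality of the bracket modulo D^j. The images of X and Y are treated as sections along φ, so
no inverse map is needed. -/
theorem fderiv_lieBracket_sub_mem (hU : IsOpen U) (hφ : ContDiffOn ℝ ∞ φ U) {j : ℕ} (hj : j ≤ r)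
    (hD : ∀ q ∈ U, ∀ v ∈ ekrFlag r w j q, fderiv ℝ φ q v ∈ ekrFlag r w j (φ q))
    {X Y : EKRSpace r → EKRSpace r} (hX : ContDiff ℝ ∞ X) (hY : ContDiff ℝ ∞ Y)
    (hX' : ∀ q, X q ∈ ekrFlag r w j q) (hY' : ∀ q, Y q ∈ ekrFlag r w j q)
    {q : EKRSpace r} (hq : q ∈ U) :
    fderiv ℝ φ q (VectorField.lieBracket ℝ X Y q) - fderiv ℝ (ekrField r w j) (φ q)
      (fderiv ℝ φ q (Y q) (pivot r w j) • fderiv ℝ φ q (X q)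
        - fderiv ℝ φ q (X q) (pivot r w j) • fderiv ℝ φ q (Y q)) ∈ ekrFlag r w j (φ q) := by
  have dX := hX.differentiable (by simp) q
  have dY := hY.differentiable (by simp) q
  have dφ : DifferentiableAt ℝ φ q :=
    (hφ.contDiffAt (hU.mem_nhds hq)).differentiableAt (by simp)
  have h1 := fderiv_section_along_sub_mem (w := w) hj dφ
    (differentiableAt_fderiv_apply hU hφ dY hq)
    (Filter.eventually_of_mem (hU.mem_nhds hq) fun q' hq' => hD q' hq' _ (hY' q')) (X q)
  have h2 := fderiv_section_along_sub_mem (w := w) hj dφ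
    (differentiableAt_fderiv_apply hU hφ dX hq)
    (Filter.eventually_of_mem (hU.mem_nhds hq) fun q' hq' => hD q' hq' _ (hX' q')) (Y q)
  have h3 := sub_mem h1 h2
  rw [fderiv_fderiv_apply_swap hU hφ hq dX dY, map_sub, map_smul, map_smul]
  rwa [sub_sub_sub_comm] at h3

/-- An injective map sending a finite-dimensional space into itself sends it onto itself. -/
theorem map_vertical_of_le {L : EKRSpace r →L[ℝ] EKRSpace r} (hL : Function.Injective L) {j : ℕ}
    (h : ∀ v ∈ vertical r j, L v ∈ vertical r j) {v : EKRSpace r} (hv : L v ∈ vertical r j) :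
    v ∈ vertical r j := by
  have e : (vertical r j).map (L : EKRSpace r →ₗ[ℝ] EKRSpace r) = vertical r j := by
    apply Submodule.eq_of_le_of_finrank_eq
    · rintro _ ⟨u, hu, rfl⟩
      exact h u hu
    · exact (Submodule.equivMapOfInjective (L : EKRSpace r →ₗ[ℝ] EKRSpace r) hL _).finrank_eq.symm
  rw [← e] at hv
  obtain ⟨u, hu, huv⟩ := hv
  rwa [← hL huv]

/-- D^j is D^{j+1} plus brackets, so naturality handles it. For the vertical space, ∂_{x^{j+1}} and
∂_{y^{j+1}} commute; the combination of their images without Z-component is therefore in the kernel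
`vertical r (j + 2)`. Pulling it back, independence of the two vectors forces both Z-components to
vanish. -/
theorem fderiv_mem_flag_step (hU : IsOpen U) (hφ : ContDiffOn ℝ ∞ φ U)
    (hinj : ∀ q ∈ U, Function.Injective (fderiv ℝ φ q)) {j : ℕ} (hj : j + 1 ≤ r)
    (hD : ∀ q ∈ U, ∀ v ∈ ekrFlag r w (j + 1) q, fderiv ℝ φ q v ∈ ekrFlag r w (j + 1) (φ q))
    (hK : ∀ q ∈ U, ∀ v ∈ vertical r (j + 2), fderiv ℝ φ q v ∈ vertical r (j + 2)) :
    (∀ q ∈ U, ∀ v ∈ ekrFlag r w j q, fderiv ℝ φ q v ∈ ekrFlag r w j (φ q)) ∧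
    (∀ q ∈ U, ∀ v ∈ vertical r (j + 1), fderiv ℝ φ q v ∈ vertical r (j + 1)) := by
  have hxy := xIdx_ne_yIdx hj hj
  constructor
  · intro q hq v hv
    obtain ⟨l, hl, h⟩ := exists_sub_fderiv_ekrField_mem hj hv
    have h1 := ekrFlag_succ_le hj _ (hD q hq _ h)
    have hl' : ∀ q', l ∈ ekrFlag r w (j + 1) q' := fun q' => vertical_le_ekrFlag hj q' hl
    have h2 := fderiv_lieBracket_sub_mem hU hφ hj hD (X := fun _ => l) contDiff_const
      (contDiff_ekrField r w (j + 1)) hl' (fun q' => ekrField_mem_ekrFlag hj q') hq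
    have h3 := fderiv_ekrField_mem hj (φ q) (w := w) (pivot_smul_sub_mem_vertical
      (hD q hq _ (hl' q)) (hD q hq _ (ekrField_mem_ekrFlag hj q)))
    have h4 := add_mem (ekrFlag_succ_le hj _ h2) h3
    rw [sub_add_cancel, lieBracket_const_left] at h4
    have h5 := add_mem h1 h4
    rwa [map_sub, sub_add_cancel] at h5
  · intro q hq v hv
    set ex : EKRSpace r := partialVec (xIdx r (j + 1)) with hex
    set ey : EKRSpace r := partialVec (yIdx r (j + 1)) with hey
    have mx : ex ∈ vertical r (j + 1) := partialVec_mem_vertical (by rw [xIdx_val hj])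
    have my : ey ∈ vertical r (j + 1) := partialVec_mem_vertical (by rw [yIdx_val hj]; omega)
    have hx' : ∀ q', ex ∈ ekrFlag r w (j + 1) q' := fun q' => vertical_le_ekrFlag hj q' mx
    have hy' : ∀ q', ey ∈ ekrFlag r w (j + 1) q' := fun q' => vertical_le_ekrFlag hj q' my
    have h1 := fderiv_lieBracket_sub_mem hU hφ hj hD (X := fun _ => ex) (Y := fun _ => ey)
      contDiff_const contDiff_const hx' hy' hq
    have h2 := pivot_smul_sub_mem_vertical (hD q hq _ (hx' q)) (hD q hq _ (hy' q))
    set a := fderiv ℝ φ q ey (pivot r w (j + 1))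
    set b := fderiv ℝ φ q ex (pivot r w (j + 1))
    rw [lieBracket_const_left] at h1
    simp only [fderiv_fun_const, Pi.zero_apply, zero_apply, map_zero, zero_sub, neg_mem_iff] at h1
    have h3 := mem_vertical_of_fderiv_ekrField_mem hj h2 h1
    rw [← map_smul, ← map_smul, ← map_sub] at h3
    have h4 := map_vertical_of_le (hinj q hq) (hK q hq) h3
    obtain ⟨-, hx, hy⟩ := (mem_vertical_succ hj).1 h4
    have ha : a = 0 := by
      simpa [hex, hey, partialVec_self, partialVec_of_ne hxy] using hx
    have hb : b = 0 := by
      simpa [hex, hey, partialVec_self, partialVec_of_ne hxy.symm] using hy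
    refine mem_vertical_of_mem_ekrFlag (hD q hq v (vertical_le_ekrFlag hj q hv)) ?_
    have h5 : v - v (xIdx r (j + 1)) • ex - v (yIdx r (j + 1)) • ey ∈ vertical r (j + 2) := by
      refine (mem_vertical_succ hj).2 ⟨sub_mem (sub_mem hv (Submodule.smul_mem _ _ mx))
        (Submodule.smul_mem _ _ my), ?_, ?_⟩
      · simp [hex, hey, partialVec_self, partialVec_of_ne hxy]
      · simp [hex, hey, partialVec_self, partialVec_of_ne hxy.symm]
    have h6 := vertical_antitone (Nat.le_succ _) (hK q hq _ h5) _ (pivot_val_lt (w := w) hj)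
    rw [map_sub, map_sub, map_smul, map_smul] at h6
    change fderiv ℝ φ q v (pivot r w (j + 1)) - v (xIdx r (j + 1)) * b
      - v (yIdx r (j + 1)) * a = 0 at h6
    rw [ha, hb] at h6
    simpa using h6

/-- A local diffeomorphism preserving the distribution preserves the members of its flag and the
members of the vertical flag. -/
theorem fderiv_mem_flag (hU : IsOpen U) (hφ : ContDiffOn ℝ ∞ φ U)
    (hinj : ∀ q ∈ U, Function.Injective (fderiv ℝ φ q))
    (hD : ∀ q ∈ U, ∀ v ∈ ekrFlag r w r q, fderiv ℝ φ q v ∈ ekrFlag r w r (φ q)) {j : ℕ}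
    (hj : j ≤ r) :
    (∀ q ∈ U, ∀ v ∈ ekrFlag r w j q, fderiv ℝ φ q v ∈ ekrFlag r w j (φ q)) ∧
    (∀ q ∈ U, ∀ v ∈ vertical r (j + 1), fderiv ℝ φ q v ∈ vertical r (j + 1)) := by
  induction hj using Nat.decreasingInduction with
  | self =>
    refine ⟨hD, fun q _ v hv => ?_⟩
    have : v = 0 := funext fun k => hv k (by have := k.isLt; omega)
    rw [this, map_zero]
    exact zero_mem _
  | of_succ j hj ih => exact fderiv_mem_flag_step hU hφ hinj hj ih.1 ih.2

/-- The coefficient of `Z[j]` in the image of `Z[j]` under `φ`. -/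
def pushCoeff (w : List ℕ) (φ : EKRSpace r → EKRSpace r) (j : ℕ) (q : EKRSpace r) : ℝ :=
  fderiv ℝ φ q (ekrField r w j q) (pivot r w j)

theorem pushCoeff_ne_zero {q : EKRSpace r} (hinj : Function.Injective (fderiv ℝ φ q)) {j : ℕ}
    (hj : j ≤ r) (hD : ∀ v ∈ ekrFlag r w j q, fderiv ℝ φ q v ∈ ekrFlag r w j (φ q))
    (hK : ∀ v ∈ vertical r j, fderiv ℝ φ q v ∈ vertical r j) : pushCoeff w φ j q ≠ 0 := fun h =>
  ekrField_notMem_vertical hj q (map_vertical_of_le hinj hK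
    (mem_vertical_of_mem_ekrFlag (hD _ (ekrField_mem_ekrFlag hj q)) h))

/-- Compare the components of the image of Z[j+1] at the pivot of Z[j], not of Z[j+1]: there only
the term x^{j+1} Z[j] contributes on either side. -/
theorem pushCoeff_succ_of_two {q : EKRSpace r} {j : ℕ} (hj : j + 1 ≤ r) (hw : w.getD j 1 = 2)
    (hD : ∀ v ∈ ekrFlag r w (j + 1) q, fderiv ℝ φ q v ∈ ekrFlag r w (j + 1) (φ q))
    (hK : ∀ v ∈ vertical r j, fderiv ℝ φ q v ∈ vertical r j) :
    q (xIdx r (j + 1)) * pushCoeff w φ j q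
      = pushCoeff w φ (j + 1) q * φ q (xIdx r (j + 1)) := by
  have hjr : j ≤ r := by omega
  have hp := pivot_val_lt (w := w) hjr
  obtain ⟨hx, hy⟩ := pivot_ne (w := w) hjr
  have h := hD _ (ekrField_mem_ekrFlag hj q) (pivot r w j) (by omega)
  have hm : (partialVec (xIdx r j) : EKRSpace r) + q (yIdx r (j + 1)) • partialVec (yIdx r j)
      ∈ vertical r j := add_mem (partialVec_mem_vertical (by rw [xIdx_val hjr]))
    (Submodule.smul_mem _ _ (partialVec_mem_vertical (by rw [yIdx_val hjr]; omega)))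
  have h' := hK _ hm _ hp
  change _ = pushCoeff w φ (j + 1) q * _ at h
  rw [ekrField_succ_two hw, ekrField_succ_two hw, add_assoc, map_add, Pi.add_apply, h', map_smul]
    at h
  simpa [pushCoeff, ekrField_pivot hjr, partialVec_of_ne hx, partialVec_of_ne hy] using h

theorem pushCoeff_succ_of_one {q : EKRSpace r} {j : ℕ} (hj : j + 1 ≤ r) (hw : w.getD j 1 = 1)
    (hK : ∀ v ∈ vertical r j, fderiv ℝ φ q v ∈ vertical r j) :
    pushCoeff w φ (j + 1) q = pushCoeff w φ j q := by
  have hjr : j ≤ r := by omega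
  have hm : q (xIdx r (j + 1)) • (partialVec (xIdx r j) : EKRSpace r)
      + q (yIdx r (j + 1)) • partialVec (yIdx r j) ∈ vertical r j :=
    add_mem (Submodule.smul_mem _ _ (partialVec_mem_vertical (by rw [xIdx_val hjr])))
    (Submodule.smul_mem _ _ (partialVec_mem_vertical (by rw [yIdx_val hjr]; omega)))
  have h' := hK _ hm _ (pivot_val_lt (w := w) hjr)
  have e : pivot r w (j + 1) = pivot r w j := by
    rw [pivot, if_neg (by omega), if_neg (by omega)]
  rw [pushCoeff, e, ekrField_succ_one (by omega) (by omega), add_assoc, map_add, Pi.add_apply, h',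
    add_zero, pushCoeff]

theorem fderiv_ekrField_apply_xIdx_of_one {q : EKRSpace r} {j : ℕ} (hj : j + 1 ≤ r)
    (hw : w.getD j 1 = 1)
    (hD : ∀ v ∈ ekrFlag r w (j + 1) q, fderiv ℝ φ q v ∈ ekrFlag r w (j + 1) (φ q)) :
    fderiv ℝ φ q (ekrField r w (j + 1) q) (xIdx r j)
      = pushCoeff w φ (j + 1) q * φ q (xIdx r (j + 1)) := by
  have hjr : j ≤ r := by omega
  have hxy := xIdx_ne_yIdx hjr hjr
  have h := hD _ (ekrField_mem_ekrFlag hj q) (xIdx r j) (by rw [xIdx_val hjr]; omega)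
  rw [ekrField_succ_one (q := φ q) (by omega) (by omega), Pi.add_apply, Pi.add_apply,
    ekrField_apply_eq_zero hjr _ (by rw [xIdx_val hjr])] at h
  simpa [pushCoeff, partialVec_self, partialVec_of_ne hxy] using h

theorem ekrField_apply_xIdx_of_one {q : EKRSpace r} {j : ℕ} (hj : j ≤ r) (hw : w.getD j 1 = 1) :
    ekrField r w (j + 1) q (xIdx r j) = q (xIdx r (j + 1)) := by
  rw [ekrField_succ_one (by omega) (by omega), Pi.add_apply, Pi.add_apply,
    ekrField_apply_eq_zero hj _ (by rw [xIdx_val hj])]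
  simp [partialVec_self, partialVec_of_ne (xIdx_ne_yIdx hj hj)]

theorem differentiableAt_pushCoeff (hU : IsOpen U) (hφ : ContDiffOn ℝ ∞ φ U) (j : ℕ)
    {q : EKRSpace r} (hq : q ∈ U) : DifferentiableAt ℝ (pushCoeff w φ j) q :=
  (differentiableAt_pi.1
    (differentiableAt_fderiv_apply hU hφ (differentiable_ekrField (w := w) j q) hq)) _

/-- Derivatives of the components of the image of `Z[j]` in vertical directions. -/
theorem fderiv_fderiv_ekrField_apply (hU : IsOpen U) (hφ : ContDiffOn ℝ ∞ φ U) (j : ℕ)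
    {q e : EKRSpace r} (hq : q ∈ U) {k : Fin (2 * r + 3)}
    (hk : ∀ q ∈ U, fderiv ℝ φ q e k = 0) :
    fderiv ℝ (fun q => fderiv ℝ φ q (ekrField r w j q) k) q e
      = fderiv ℝ φ q (fderiv ℝ (ekrField r w j) q e) k := by
  have dZ := differentiable_ekrField (w := w) j q
  have h := fderiv_fderiv_apply_swap hU hφ hq (X := fun _ => e) (by simp) dZ
  have d1 := differentiableAt_fderiv_apply hU hφ dZ hq
  have d2 := differentiableAt_fderiv_apply hU hφ (X := fun _ => e) (by simp) hq
  have h2 := congrFun h k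
  rw [Pi.sub_apply, ← fderiv_apply_coord d1, ← fderiv_apply_coord d2, lieBracket_const_left] at h2
  have e0 : (fun q => fderiv ℝ φ q e k) =ᶠ[𝓝 q] fun _ => 0 :=
    Filter.eventually_of_mem (hU.mem_nhds hq) hk
  rw [e0.fderiv_eq] at h2
  simpa using h2.symm

/-- A vertical constant e commutes with Z[j], and its image has no pivot component; exchanging the
order of differentiation gives zero. -/
theorem fderiv_pushCoeff_of_mem_vertical (hU : IsOpen U) (hφ : ContDiffOn ℝ ∞ φ U) {j : ℕ}
    (hj : j ≤ r) (hK : ∀ q ∈ U, ∀ v ∈ vertical r (j + 1), fderiv ℝ φ q v ∈ vertical r (j + 1))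
    {q e : EKRSpace r} (hq : q ∈ U) (he : e ∈ vertical r (j + 1)) :
    fderiv ℝ (pushCoeff w φ j) q e = 0 := by
  have hp := pivot_val_lt (w := w) hj
  have h := fderiv_fderiv_ekrField_apply (w := w) hU hφ j hq (e := e) (k := pivot r w j)
    (fun q hq => hK q hq e he _ (by omega))
  rw [fderiv_ekrField_eq_zero hj q he, map_zero] at h
  exact h

/-- Functions vanishing on the intersection of an open set with a coordinate hyperplane have
vanishing derivatives along that hyperplane. -/
theorem fderiv_eq_zero_of_hyperplane (hU : IsOpen U) {h : EKRSpace r → ℝ} {p e : EKRSpace r}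
    {k : Fin (2 * r + 3)} (hp : p ∈ U) (hpk : p k = 0) (hek : e k = 0)
    (hd : DifferentiableAt ℝ h p) (h0 : ∀ q ∈ U, q k = 0 → h q = 0) : fderiv ℝ h p e = 0 := by
  have hl : HasDerivAt (fun s : ℝ => p + s • e) e 0 := by
    simpa using ((hasDerivAt_id (0 : ℝ)).smul_const e).const_add p
  have hd' : HasFDerivAt h (fderiv ℝ h p) (p + (0 : ℝ) • e) := by simpa using hd.hasFDerivAt
  have h1 := hd'.comp_hasDerivAt (0 : ℝ) hl
  have h2 : (h ∘ fun s : ℝ => p + s • e) =ᶠ[𝓝 0] fun _ => 0 := by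
    have hc : ContinuousAt (fun s : ℝ => p + s • e) 0 := hl.continuousAt
    have : U ∈ 𝓝 (p + (0 : ℝ) • e) := by simpa using hU.mem_nhds hp
    filter_upwards [hc this] with s hs
    exact h0 _ hs (by simp [hpk, hek])
  exact h1.unique ((hasDerivAt_const (0 : ℝ) (0 : ℝ)).congr_of_eventuallyEq h2)

/-- Differentiate x^{j+1} a_j = a_{j+1} X^{j+1} along Z[j+2]. Where x^{j+1} = 0 also X^{j+1} = 0,
since a_{j+1} ≠ 0, so derivatives of the factors drop out. One factor a_{j+1} comes from the
relation; the other is a_{j+2}, equal to it because of the letter 1. -/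
theorem pushCoeff_of_two_one (hU : IsOpen U) (hφ : ContDiffOn ℝ ∞ φ U)
    (hinj : ∀ q ∈ U, Function.Injective (fderiv ℝ φ q))
    (hD : ∀ q ∈ U, ∀ v ∈ ekrFlag r w r q, fderiv ℝ φ q v ∈ ekrFlag r w r (φ q)) {j : ℕ}
    (h1j : 1 ≤ j) (hj : j + 2 ≤ r) (hw : w.getD j 1 = 2) (hw' : w.getD (j + 1) 1 = 1)
    {q : EKRSpace r}
    (hq : q ∈ U) (hx : q (xIdx r (j + 1)) = 0) :
    q (xIdx r (j + 2)) * pushCoeff w φ j q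
      = pushCoeff w φ (j + 1) q ^ 2 * φ q (xIdx r (j + 2)) := by
  have H := fun i (hi : i ≤ r) => fderiv_mem_flag hU hφ hinj hD hi
  obtain ⟨i, rfl⟩ : ∃ i, j = i + 1 := ⟨j - 1, by omega⟩
  have rel : ∀ q ∈ U, q (xIdx r (i + 2)) * pushCoeff w φ (i + 1) q
      = pushCoeff w φ (i + 2) q * φ q (xIdx r (i + 2)) := fun q hq =>
    pushCoeff_succ_of_two (by omega) hw ((H (i + 2) (by omega)).1 q hq)
      ((H i (by omega)).2 q hq)
  have hne : pushCoeff w φ (i + 2) q ≠ 0 := pushCoeff_ne_zero (hinj q hq) (by omega)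
    ((H (i + 2) (by omega)).1 q hq) ((H (i + 1) (by omega)).2 q hq)
  have hX : φ q (xIdx r (i + 2)) = 0 := by
    have := rel q hq
    rw [hx, zero_mul] at this
    exact (mul_eq_zero.1 this.symm).resolve_left hne
  have hc : DifferentiableAt ℝ (fun q : EKRSpace r => q (xIdx r (i + 2))) q :=
    differentiableAt_apply _ q
  have dφ : DifferentiableAt ℝ φ q :=
    (hφ.contDiffAt (hU.mem_nhds hq)).differentiableAt (by simp)
  have dφx : DifferentiableAt ℝ (fun q => φ q (xIdx r (i + 2))) q := (differentiableAt_pi.1 dφ) _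
  have d1 := differentiableAt_pushCoeff (w := w) hU hφ (i + 1) hq
  have d2 := differentiableAt_pushCoeff (w := w) hU hφ (i + 2) hq
  have ee : (fun q => q (xIdx r (i + 2)) * pushCoeff w φ (i + 1) q) =ᶠ[𝓝 q]
      fun q => pushCoeff w φ (i + 2) q * φ q (xIdx r (i + 2)) :=
    Filter.eventually_of_mem (hU.mem_nhds hq) rel
  have e1 := congrArg (fun L : EKRSpace r →L[ℝ] ℝ => L (ekrField r w (i + 3) q)) ee.fderiv_eq
  rw [fderiv_fun_mul hc d1, fderiv_fun_mul d2 dφx] at e1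
  simp only [add_apply, smul_apply, fderiv_coord, smul_eq_mul, hX, zero_mul, add_zero] at e1
  have hx' : q (xIdx r (i + 2)) = 0 := hx
  rw [hx', zero_mul, zero_add, fderiv_apply_coord dφ,
    ekrField_apply_xIdx_of_one (j := i + 2) (by omega) hw',
    fderiv_ekrField_apply_xIdx_of_one (j := i + 2) (by omega) hw'
      ((H (i + 3) (by omega)).1 q hq),
    pushCoeff_succ_of_one (j := i + 2) (by omega) hw' ((H (i + 1) (by omega)).2 q hq)] at e1
  linear_combination e1

/-- The 2.1 relation holds along x^{j+1} = 0, so it may be differentiated along ∂_{x^{j+2}}, on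
which a_j and a_{j+1} are constant. At p this direction is Z[j+3] itself, so the derivative of
X^{j+2} is a_{j+3}. -/
theorem pushCoeff_of_two_one_two (hU : IsOpen U) (hφ : ContDiffOn ℝ ∞ φ U)
    (hinj : ∀ q ∈ U, Function.Injective (fderiv ℝ φ q))
    (hD : ∀ q ∈ U, ∀ v ∈ ekrFlag r w r q, fderiv ℝ φ q v ∈ ekrFlag r w r (φ q)) {j : ℕ}
    (h1j : 1 ≤ j) (hj : j + 3 ≤ r) (hw : w.getD j 1 = 2) (hw' : w.getD (j + 1) 1 = 1)
    (hw'' : w.getD (j + 2) 1 = 2) {p : EKRSpace r}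
    (hp : p ∈ U) (hx : p (xIdx r (j + 1)) = 0) (hx' : p (xIdx r (j + 3)) = 0)
    (hy' : p (yIdx r (j + 3)) = 0) :
    pushCoeff w φ j p = pushCoeff w φ (j + 1) p ^ 2 * pushCoeff w φ (j + 3) p := by
  have H := fun i (hi : i ≤ r) => fderiv_mem_flag hU hφ hinj hD hi
  set e : EKRSpace r := partialVec (xIdx r (j + 2)) with he
  have x1 := xIdx_val (r := r) (j := j + 1) (by omega)
  have x2 := xIdx_val (r := r) (j := j + 2) (by omega)
  have hev : e ∈ vertical r (j + 2) := partialVec_mem_vertical (by omega)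
  have hc : DifferentiableAt ℝ (fun q : EKRSpace r => q (xIdx r (j + 2))) p :=
    differentiableAt_apply _ p
  have dφ : DifferentiableAt ℝ φ p :=
    (hφ.contDiffAt (hU.mem_nhds hp)).differentiableAt (by simp)
  have dφx : DifferentiableAt ℝ (fun q => φ q (xIdx r (j + 2))) p := (differentiableAt_pi.1 dφ) _
  have d1 := differentiableAt_pushCoeff (w := w) hU hφ j hp
  have d2 := differentiableAt_pushCoeff (w := w) hU hφ (j + 1) hp
  have z1 := fderiv_pushCoeff_of_mem_vertical (w := w) hU hφ (j := j) (by omega)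
    (H j (by omega)).2 hp (vertical_antitone (by omega) hev)
  have z2 := fderiv_pushCoeff_of_mem_vertical (w := w) hU hφ (j := j + 1) (by omega)
    (H (j + 1) (by omega)).2 hp hev
  have h0 := fderiv_eq_zero_of_hyperplane hU (e := e) hp hx
    (partialVec_of_ne fun h => by have := congrArg Fin.val h; omega)
    ((hc.fun_mul d1).fun_sub ((d2.fun_mul d2).fun_mul dφx)) (fun q hq hqx => by
      have := pushCoeff_of_two_one hU hφ hinj hD h1j (by omega) hw hw' hq hqx
      linear_combination this)
  rw [fderiv_fun_sub (hc.fun_mul d1) ((d2.fun_mul d2).fun_mul dφx), fderiv_fun_mul hc d1,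
    fderiv_fun_mul (d2.fun_mul d2) dφx, fderiv_fun_mul d2 d2] at h0
  simp only [sub_apply, add_apply, smul_apply, fderiv_coord, smul_eq_mul, z1, z2,
    fderiv_apply_coord dφ, mul_zero, add_zero, zero_add] at h0
  have he1 : e (xIdx r (j + 2)) = 1 := partialVec_self _
  have hz : ekrField r w (j + 3) p = e := by
    have h := ekrField_succ_two hw'' p
    rw [show j + 2 + 1 = j + 3 from rfl, hx', hy'] at h
    simpa using h
  have hpv : pivot r w (j + 3) = xIdx r (j + 2) := by rw [pivot, if_pos hw'']
  have h4 : pushCoeff w φ (j + 3) p = fderiv ℝ φ p e (xIdx r (j + 2)) := by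
    rw [pushCoeff, hz, hpv]
  rw [h4]
  rw [he1] at h0
  linear_combination h0

end Morphism

/-! ### The parameter c is an invariant of the germ. -/

section Inequivalence

theorem pointP_apply (c : ℝ) (k : Fin (2 * 7 + 3)) : pointP c k
    = (if k.val = 7 then 1 else 0) + (if k.val = 11 then 1 else 0)
      + c * (if k.val = 15 then 1 else 0) := by
  have h : ∀ l : Fin (2 * 7 + 3),
      (partialVec l : EKRSpace 7) k = if k.val = l.val then 1 else 0 := fun l => by
    simp [partialVec, Pi.single_apply, Fin.ext_iff]
  simp only [pointP, Pi.add_apply, Pi.smul_apply, smul_eq_mul, h]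
  rfl

theorem pointP_xIdx (c : ℝ) {j : ℕ} (hj : j ≤ 7) : pointP c (xIdx 7 j)
    = (if j = 3 then 1 else 0) + (if j = 5 then 1 else 0) + c * (if j = 7 then 1 else 0) := by
  rw [pointP_apply, xIdx_val hj]
  interval_cases j <;> simp

theorem pointP_yIdx (c : ℝ) {j : ℕ} (hj : j ≤ 7) : pointP c (yIdx 7 j) = 0 := by
  rw [pointP_apply, yIdx_val hj]
  interval_cases j <;> simp

theorem not_germEquivalent_Delta7 {c c' : ℝ} (hcc : c ≠ c') :
    ¬ GermEquivalent Delta7 (pointP c) Delta7 (pointP c') := by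
  rintro ⟨φ, hp, hpp, hφ, hψ, hmap⟩
  have hU := φ.open_source
  have hinj : ∀ q ∈ φ.source, Function.Injective (fderiv ℝ φ q) := by
    intro q hq
    have d1 : DifferentiableAt ℝ φ q := (hφ.contDiffAt (hU.mem_nhds hq)).differentiableAt (by simp)
    have d2 : DifferentiableAt ℝ φ.symm (φ q) :=
      (hψ.contDiffAt (φ.open_target.mem_nhds (φ.map_source hq))).differentiableAt (by simp)
    have e : (φ.symm ∘ φ) =ᶠ[𝓝 q] id :=
      Filter.eventually_of_mem (hU.mem_nhds hq) fun q' hq' => φ.left_inv hq'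
    have h := e.fderiv_eq (𝕜 := ℝ)
    rw [fderiv_comp q d2 d1, fderiv_id] at h
    have h' : ∀ v, fderiv ℝ φ.symm (φ q) (fderiv ℝ φ q v) = v :=
      fun v => congrArg (fun L : EKRSpace 7 →L[ℝ] EKRSpace 7 => L v) h
    exact Function.LeftInverse.injective h'
  have hD : ∀ q ∈ φ.source, ∀ v ∈ ekrFlag 7 code7 7 q,
      fderiv ℝ φ q v ∈ ekrFlag 7 code7 7 (φ q) := by
    intro q hq v hv
    have e := ekrDistribution_eq 7 code7
    have h := hmap q hq
    rw [Delta7, e] at h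
    rw [← h]
    exact ⟨v, hv, rfl⟩
  have H := fun i (hi : i ≤ 7) => fderiv_mem_flag hU hφ hinj hD hi
  have A := fun j h1 h2 h3 h4 h5 =>
    pushCoeff_of_two_one hU hφ hinj hD (j := j) h1 h2 h3 h4 hp h5
  have B := fun j h1 h2 h3 h4 h5 h6 h7 h8 =>
    pushCoeff_of_two_one_two hU hφ hinj hD (j := j) h1 h2 h3 h4 h5 hp h6 h7 h8
  -- Only the 2.1 relations mention the image point; the 2.1.2 relations involve the factors alone.
  rw [hpp] at A
  have A1 := A 1 (by norm_num) (by norm_num) rfl rfl (by simp [pointP_xIdx])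
  have A5 := A 5 (by norm_num) (by norm_num) rfl rfl (by simp [pointP_xIdx])
  have A3 := A 3 (by norm_num) (by norm_num) rfl rfl (by simp [pointP_xIdx])
  have B1 := B 1 (by norm_num) (by norm_num) rfl rfl rfl (by simp [pointP_xIdx])
    (by simp [pointP_xIdx]) (by simp [pointP_yIdx])
  have B3 := B 3 (by norm_num) (by norm_num) rfl rfl rfl (by simp [pointP_xIdx])
    (by simp [pointP_xIdx]) (by simp [pointP_yIdx])
  have n2 : pushCoeff code7 φ 2 (pointP c) ≠ 0 := pushCoeff_ne_zero (hinj _ hp) (by norm_num)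
    ((H 2 (by norm_num)).1 _ hp) ((H 1 (by norm_num)).2 _ hp)
  have e5 : pushCoeff code7 φ 5 (pointP c) = pushCoeff code7 φ 4 (pointP c) :=
    pushCoeff_succ_of_one (j := 4) (by norm_num) rfl ((H 3 (by norm_num)).2 _ hp)
  simp [pointP_xIdx] at A1 A3 A5 B1 B3
  have e4 : pushCoeff code7 φ 4 (pointP c) = 1 := by
    -- Here a_1 = a_2^2 (from x^3 = 1 at both points) meets a_1 = a_2^2 a_4.
    have : pushCoeff code7 φ 2 (pointP c) ^ 2 * (pushCoeff code7 φ 4 (pointP c) - 1) = 0 := by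
      linear_combination A1 - B1
    rcases mul_eq_zero.1 this with h | h
    · exact absurd (pow_eq_zero_iff (by norm_num) |>.1 h) n2
    · linarith
  rw [e4] at A3 B3 e5
  have e6 : pushCoeff code7 φ 6 (pointP c) = 1 := by linarith
  rw [e5, e6] at A5
  exact hcc (by linarith)

end Inequivalence

/-! ### Infinitesimal symmetries: the linearised relations, with b_j = `pushCoeff w Y j`. -/

section Symmetry

variable {r : ℕ} {w : List ℕ} {Y : EKRSpace r → EKRSpace r} {U : Set (EKRSpace r)}

/-- The tensorial form of `[Y, D^j] ⊆ D^j` over `U`. -/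
def InfinitesimallyPreserves (w : List ℕ) (Y : EKRSpace r → EKRSpace r) (U : Set (EKRSpace r))
    (j : ℕ) : Prop :=
  ∀ q ∈ U, ∀ v ∈ ekrFlag r w j q,
    v (pivot r w j) • fderiv ℝ (ekrField r w j) q (Y q) - fderiv ℝ Y q v ∈ ekrFlag r w j q

theorem lieBracket_mem_iff {j : ℕ} (hj : j ≤ r) {X : EKRSpace r → EKRSpace r} {q : EKRSpace r}
    (hX : DifferentiableAt ℝ X q) (hX' : ∀ᶠ q' in 𝓝 q, X q' ∈ ekrFlag r w j q') :
    VectorField.lieBracket ℝ Y X q ∈ ekrFlag r w j q ↔ X q (pivot r w j) •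
      fderiv ℝ (ekrField r w j) q (Y q) - fderiv ℝ Y q (X q) ∈ ekrFlag r w j q := by
  have h := fderiv_section_sub_mem hj hX hX' (Y q)
  rw [VectorField.lieBracket_eq]
  beta_reduce
  rw [← sub_add_sub_cancel _ (X q (pivot r w j) • fderiv ℝ (ekrField r w j) q (Y q))]
  exact Submodule.add_mem_iff_right _ h

theorem infinitesimallyPreserves_of_preserves (hU : IsOpen U)
    (hP : Preserves Y (ekrFlag r w r) U) : InfinitesimallyPreserves w Y U r := by
  intro q hq v hv
  obtain ⟨X, hX, hX', rfl⟩ := exists_section le_rfl hv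
  exact (lieBracket_mem_iff le_rfl (hX.differentiable (by simp) q)
    (Filter.Eventually.of_forall hX')).1
    ((hP U hU subset_rfl X ⟨hX.contDiffOn, fun q _ => hX' q⟩).2 q hq)

/-- By the Jacobi identity, [Y, [X, X']] is a sum of two brackets of sections of D^j, each a
vertical derivative of Z[j] modulo D^j. -/
theorem lieBracket_lieBracket_mem (hU : IsOpen U) (hY : ContDiffOn ℝ ∞ Y U) {j : ℕ} (hj : j ≤ r)
    (hP : InfinitesimallyPreserves w Y U j)
    {X X' : EKRSpace r → EKRSpace r} (hX : ContDiff ℝ ∞ X) (hX' : ContDiff ℝ ∞ X')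
    (mX : ∀ q, X q ∈ ekrFlag r w j q) (mX' : ∀ q, X' q ∈ ekrFlag r w j q)
    {q : EKRSpace r} (hq : q ∈ U) :
    ∃ u ∈ vertical r j, u
      = X' q (pivot r w j) • VectorField.lieBracket ℝ Y X q
        - VectorField.lieBracket ℝ Y X q (pivot r w j) • X' q
        + (VectorField.lieBracket ℝ Y X' q (pivot r w j) • X q
        - X q (pivot r w j) • VectorField.lieBracket ℝ Y X' q) ∧
      VectorField.lieBracket ℝ Y (VectorField.lieBracket ℝ X X') q
        - fderiv ℝ (ekrField r w j) q u ∈ ekrFlag r w j q := by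
  have key : ∀ X : EKRSpace r → EKRSpace r, ContDiff ℝ ∞ X → (∀ q, X q ∈ ekrFlag r w j q) →
      IsSection (ekrFlag r w j) U (VectorField.lieBracket ℝ Y X) := fun X hX mX =>
    ⟨contDiffOn_lieBracket hU hY hX.contDiffOn, fun q hq =>
      (lieBracket_mem_iff hj (hX.differentiable (by simp) q)
        (Filter.Eventually.of_forall mX)).2 (hP q hq _ (mX q))⟩
  have k := key X hX mX
  have k' := key X' hX' mX'
  have h1 := lieBracket_section_sub_mem hj (k.differentiableAt hU hq)
    (hX'.differentiable (by simp) q) (k.eventually_mem hU hq) (Filter.Eventually.of_forall mX')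
  have h2 := lieBracket_section_sub_mem hj (hX.differentiable (by simp) q)
    (k'.differentiableAt hU hq) (Filter.Eventually.of_forall mX) (k'.eventually_mem hU hq)
  refine ⟨_, add_mem (pivot_smul_sub_mem_vertical (k.2 q hq) (mX' q))
    (pivot_smul_sub_mem_vertical (mX q) (k'.2 q hq)), rfl, ?_⟩
  rw [VectorField.leibniz_identity_lieBracket (n := ∞) (by simp; norm_cast)
    (hY.contDiffAt (hU.mem_nhds hq)) hX.contDiffAt hX'.contDiffAt, map_add]
  have h3 := add_mem h1 h2
  rwa [sub_add_sub_comm] at h3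

/-- Apply the Jacobi computation to commuting constant fields ∂_{x^{j+1}} and l: the resulting
combination lies in `vertical r (j + 2)`. Taking l = ∂_{y^{j+1}} first kills the pivot component for
∂_{x^{j+1}}; then l = v kills it for v. -/
theorem InfinitesimallyPreserves.vertical (hU : IsOpen U) (hY : ContDiffOn ℝ ∞ Y U) {j : ℕ}
    (hj : j + 1 ≤ r) (hP : InfinitesimallyPreserves w Y U (j + 1)) {q : EKRSpace r} (hq : q ∈ U)
    {v : EKRSpace r} (hv : v ∈ vertical r (j + 1)) : fderiv ℝ Y q v ∈ vertical r (j + 1) := by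
  have hxy := xIdx_ne_yIdx hj hj
  have hp := pivot_val_lt (w := w) hj
  set ex : EKRSpace r := partialVec (xIdx r (j + 1)) with hex
  have mx : ex ∈ SpecialFlag.vertical r (j + 1) := partialVec_mem_vertical (by rw [xIdx_val hj])
  have my : (partialVec (yIdx r (j + 1)) : EKRSpace r) ∈ SpecialFlag.vertical r (j + 1) :=
    partialVec_mem_vertical (by rw [yIdx_val hj]; omega)
  have key : ∀ l ∈ SpecialFlag.vertical r (j + 1),
      fderiv ℝ Y q ex (pivot r w (j + 1)) • l - fderiv ℝ Y q l (pivot r w (j + 1)) • ex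
        ∈ SpecialFlag.vertical r (j + 2) := by
    intro l hl
    obtain ⟨u, hu, e, h⟩ := lieBracket_lieBracket_mem hU hY hj hP (X := fun _ => ex)
      (X' := fun _ => l) contDiff_const contDiff_const
      (fun q => vertical_le_ekrFlag hj q mx) (fun q => vertical_le_ekrFlag hj q hl) hq
    have h0 : VectorField.lieBracket ℝ (fun _ => ex) (fun _ => l) = 0 := by
      rw [lieBracket_const_left]
      funext q
      simp
    rw [h0, VectorField.lieBracket_zero_right, Pi.zero_apply, zero_sub, neg_mem_iff] at h
    have hu' := mem_vertical_of_fderiv_ekrField_mem hj hu h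
    rw [e] at hu'
    simp only [hl _ hp, mx _ hp, VectorField.lieBracket_eq, fderiv_fun_const, Pi.zero_apply,
      zero_apply, zero_sub, zero_smul, Pi.neg_apply, sub_zero, neg_smul, neg_neg] at hu'
    rwa [← sub_eq_add_neg] at hu'
  have hx0 : fderiv ℝ Y q ex (pivot r w (j + 1)) = 0 := by
    have := ((mem_vertical_succ hj).1 (key _ my)).2.2
    simpa [hex, partialVec_self, partialVec_of_ne hxy.symm] using this
  have hv0 : fderiv ℝ Y q v (pivot r w (j + 1)) = 0 := by
    have := ((mem_vertical_succ hj).1 (key _ hv)).2.1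
    rw [hx0] at this
    simpa [hex, partialVec_self] using this
  have h := hP q hq v (vertical_le_ekrFlag hj q hv)
  rw [hv _ hp, zero_smul, zero_sub, neg_mem_iff] at h
  exact mem_vertical_of_mem_ekrFlag h hv0

/-- Split v into a value of D^{j+1} and a bracket [l, Z[j+1]]; the Jacobi identity controls the
second part, and the tensorial condition is additive. -/
theorem InfinitesimallyPreserves.of_succ (hU : IsOpen U) (hY : ContDiffOn ℝ ∞ Y U) {j : ℕ}
    (hj : j + 1 ≤ r) (hP : InfinitesimallyPreserves w Y U (j + 1)) :
    InfinitesimallyPreserves w Y U j := by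
  intro q hq v hv
  have hjr : j ≤ r := by omega
  obtain ⟨l, hl, h⟩ := exists_sub_fderiv_ekrField_mem hj hv
  have hl' : ∀ q', l ∈ ekrFlag r w (j + 1) q' := fun q' => vertical_le_ekrFlag hj q' hl
  obtain ⟨X, hX, mX, hXv⟩ := exists_section hj h
  have h1 := (lieBracket_mem_iff (Y := Y) hjr (hX.differentiable (by simp) q)
    (Filter.Eventually.of_forall fun q' => ekrFlag_succ_le hj q' (mX q'))).1
    (ekrFlag_succ_le hj q ((lieBracket_mem_iff hj (hX.differentiable (by simp) q)
      (Filter.Eventually.of_forall mX)).2 (hP q hq _ (mX q))))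
  obtain ⟨u, hu, -, hu'⟩ := lieBracket_lieBracket_mem hU hY hj hP (X := fun _ => l)
    contDiff_const (contDiff_ekrField r w (j + 1)) hl' (fun q' => ekrField_mem_ekrFlag hj q') hq
  have h2 := add_mem (ekrFlag_succ_le hj q hu') (fderiv_ekrField_mem hj q hu)
  have hc : ContDiff ℝ ∞ (VectorField.lieBracket ℝ (fun _ => l) (ekrField r w (j + 1))) :=
    contDiff_const.lieBracket_vectorField (n := ∞) (contDiff_ekrField r w (j + 1)) (by simp)
  rw [sub_add_cancel, lieBracket_mem_iff hjr (hc.differentiable (by simp) q)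
    (Filter.Eventually.of_forall fun q' => by
      rw [lieBracket_const_left]; exact fderiv_ekrField_mem hj q' hl), lieBracket_const_left] at h2
  rw [hXv] at h1
  have h3 := add_mem h1 h2
  rw [sub_add_sub_comm, ← add_smul, ← map_add, sub_add_cancel, ← Pi.add_apply, sub_add_cancel]
    at h3
  exact h3

theorem infinitesimallyPreserves_of_le (hU : IsOpen U) (hY : ContDiffOn ℝ ∞ Y U)
    (hP : InfinitesimallyPreserves w Y U r) {j : ℕ} (hj : j ≤ r) :
    InfinitesimallyPreserves w Y U j := by
  induction hj using Nat.decreasingInduction with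
  | self => exact hP
  | of_succ j hj ih => exact ih.of_succ hU hY hj

/-- The components of `[Z[j], Y] = c Z[j]` modulo vertical vectors. -/
theorem InfinitesimallyPreserves.apply {j : ℕ} (hj : j ≤ r) (hP : InfinitesimallyPreserves w Y U j)
    {q : EKRSpace r} (hq : q ∈ U) {k : Fin (2 * r + 3)} (hk : k.val < 2 * j + 1) :
    fderiv ℝ Y q (ekrField r w j q) k = fderiv ℝ (ekrField r w j) q (Y q) k
      + pushCoeff w Y j q * ekrField r w j q k := by
  have h := hP q hq _ (ekrField_mem_ekrFlag hj q) k hk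
  simp only [ekrField_pivot hj, one_smul, Pi.sub_apply, fderiv_ekrField_pivot hj, zero_sub] at h
  rw [pushCoeff]
  linear_combination -h

theorem InfinitesimallyPreserves.xIdx_of_two {j : ℕ} (hj : j + 1 ≤ r) (hw : w.getD j 1 = 2)
    (hP : InfinitesimallyPreserves w Y U (j + 1)) {q : EKRSpace r} (hq : q ∈ U)
    (hK : ∀ v ∈ SpecialFlag.vertical r j, fderiv ℝ Y q v ∈ SpecialFlag.vertical r j) :
    Y q (xIdx r (j + 1))
      = q (xIdx r (j + 1)) * (pushCoeff w Y j q - pushCoeff w Y (j + 1) q) := by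
  have hjr : j ≤ r := by omega
  have hp := pivot_val_lt (w := w) hjr
  obtain ⟨hx, hy⟩ := pivot_ne (w := w) hjr
  have h := hP.apply hj hq (k := pivot r w j) (by omega)
  have hm : (partialVec (xIdx r j) : EKRSpace r) + q (yIdx r (j + 1)) • partialVec (yIdx r j)
      ∈ SpecialFlag.vertical r j := add_mem (partialVec_mem_vertical (by rw [xIdx_val hjr]))
    (Submodule.smul_mem _ _ (partialVec_mem_vertical (by rw [yIdx_val hjr]; omega)))
  have h' := hK _ hm _ hp
  rw [fderiv_ekrField_succ_two hw, ekrField_succ_two hw, add_assoc (_ • ekrField r w j q), map_add,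
    Pi.add_apply, h', map_smul] at h
  simp only [Pi.add_apply, Pi.smul_apply, smul_eq_mul, ekrField_pivot hjr,
    fderiv_ekrField_pivot hjr, partialVec_of_ne hx, partialVec_of_ne hy] at h
  change q (xIdx r (j + 1)) * pushCoeff w Y j q + 0 = _ at h
  linear_combination -h

theorem InfinitesimallyPreserves.xIdx_of_one {j : ℕ} (hj : j + 1 ≤ r) (hw : w.getD j 1 = 1)
    (hP : InfinitesimallyPreserves w Y U (j + 1)) {q : EKRSpace r} (hq : q ∈ U) :
    fderiv ℝ Y q (ekrField r w (j + 1) q) (xIdx r j)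
      = Y q (xIdx r (j + 1)) + pushCoeff w Y (j + 1) q * q (xIdx r (j + 1)) := by
  have hjr : j ≤ r := by omega
  have hxy := xIdx_ne_yIdx hjr hjr
  have hz : fderiv ℝ (ekrField r w j) q (Y q) (xIdx r j) = 0 := by
    rw [← fderiv_apply_coord (differentiable_ekrField j q)]
    have : (fun q => ekrField r w j q (xIdx r j)) = fun _ => 0 :=
      funext fun q => ekrField_apply_eq_zero hjr q (by rw [xIdx_val hjr])
    simp [this]
  rw [hP.apply hj hq (k := xIdx r j) (by rw [xIdx_val hjr]; omega),
    ekrField_apply_xIdx_of_one hjr hw, fderiv_ekrField_succ_one hw]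
  simp [hz, partialVec_self, partialVec_of_ne hxy]

/-- Derivative along Z[j+2] of the letter-2 relation; the second copy of b_{j+1} is b_{j+2}, by the
letter 1. -/
theorem symmetry_xIdx_of_two_one (hU : IsOpen U) (hY : ContDiffOn ℝ ∞ Y U)
    (hP : InfinitesimallyPreserves w Y U r) {j : ℕ} (h1j : 1 ≤ j) (hj : j + 2 ≤ r)
    (hw : w.getD j 1 = 2) (hw' : w.getD (j + 1) 1 = 1) {q : EKRSpace r} (hq : q ∈ U)
    (hx : q (xIdx r (j + 1)) = 0) :
    Y q (xIdx r (j + 2))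
      = q (xIdx r (j + 2)) * (pushCoeff w Y j q - 2 * pushCoeff w Y (j + 1) q) := by
  have H := fun i (hi : i ≤ r) => infinitesimallyPreserves_of_le hU hY hP hi
  obtain ⟨i, rfl⟩ : ∃ i, j = i + 1 := ⟨j - 1, by omega⟩
  have rel : ∀ q ∈ U, Y q (xIdx r (i + 2))
      = q (xIdx r (i + 2)) * (pushCoeff w Y (i + 1) q - pushCoeff w Y (i + 2) q) := fun q hq =>
    (H (i + 2) (by omega)).xIdx_of_two (by omega) hw hq
      fun v hv => (H (i + 1) (by omega)).vertical hU hY (by omega) hq hv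
  have hc : DifferentiableAt ℝ (fun q : EKRSpace r => q (xIdx r (i + 2))) q :=
    differentiableAt_apply _ q
  have dY : DifferentiableAt ℝ Y q :=
    (hY.contDiffAt (hU.mem_nhds hq)).differentiableAt (by simp)
  have d := (differentiableAt_pushCoeff (w := w) hU hY (i + 1) hq).fun_sub
    (differentiableAt_pushCoeff (w := w) hU hY (i + 2) hq)
  have ee : (fun q => Y q (xIdx r (i + 2))) =ᶠ[𝓝 q]
      fun q => q (xIdx r (i + 2)) * (pushCoeff w Y (i + 1) q - pushCoeff w Y (i + 2) q) :=
    Filter.eventually_of_mem (hU.mem_nhds hq) rel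
  have e1 := congrArg (fun L : EKRSpace r →L[ℝ] ℝ => L (ekrField r w (i + 3) q)) ee.fderiv_eq
  have hx' : q (xIdx r (i + 2)) = 0 := hx
  rw [fderiv_fun_mul hc d] at e1
  simp only [add_apply, smul_apply, fderiv_coord, smul_eq_mul, hx', zero_mul, zero_add] at e1
  rw [fderiv_apply_coord dY, ekrField_apply_xIdx_of_one (j := i + 2) (by omega) hw',
    (H (i + 3) (by omega)).xIdx_of_one (j := i + 2) (by omega) hw' hq,
    pushCoeff_succ_of_one (j := i + 2) (by omega) hw'
      fun v hv => (H (i + 2) (by omega)).vertical hU hY (by omega) hq hv] at e1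
  linear_combination e1

/-- As for diffeomorphisms: differentiate along ∂_{x^{j+2}} within x^{j+1} = 0, a direction equal to
Z[j+3] at p. -/
theorem pushCoeff_symmetry_of_two_one_two (hU : IsOpen U) (hY : ContDiffOn ℝ ∞ Y U)
    (hP : InfinitesimallyPreserves w Y U r) {j : ℕ} (h1j : 1 ≤ j) (hj : j + 3 ≤ r)
    (hw : w.getD j 1 = 2) (hw' : w.getD (j + 1) 1 = 1) (hw'' : w.getD (j + 2) 1 = 2)
    {p : EKRSpace r} (hp : p ∈ U) (hx : p (xIdx r (j + 1)) = 0) (hx' : p (xIdx r (j + 3)) = 0)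
    (hy' : p (yIdx r (j + 3)) = 0) :
    pushCoeff w Y (j + 3) p = pushCoeff w Y j p - 2 * pushCoeff w Y (j + 1) p := by
  have H := fun i (hi : i ≤ r) => infinitesimallyPreserves_of_le hU hY hP hi
  have HV := fun i (hi : i + 1 ≤ r) q (hq : q ∈ U) v (hv : v ∈ SpecialFlag.vertical r (i + 1)) =>
    (H (i + 1) hi).vertical hU hY hi hq hv
  set e : EKRSpace r := partialVec (xIdx r (j + 2)) with he
  have x1 := xIdx_val (r := r) (j := j + 1) (by omega)
  have x2 := xIdx_val (r := r) (j := j + 2) (by omega)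
  have hev : e ∈ SpecialFlag.vertical r (j + 2) := partialVec_mem_vertical (by omega)
  have hc : DifferentiableAt ℝ (fun q : EKRSpace r => q (xIdx r (j + 2))) p :=
    differentiableAt_apply _ p
  have dY : DifferentiableAt ℝ Y p :=
    (hY.contDiffAt (hU.mem_nhds hp)).differentiableAt (by simp)
  have dYx : DifferentiableAt ℝ (fun q => Y q (xIdx r (j + 2))) p := (differentiableAt_pi.1 dY) _
  have d1 := differentiableAt_pushCoeff (w := w) hU hY j hp
  have d2 := differentiableAt_pushCoeff (w := w) hU hY (j + 1) hp
  have d := d1.fun_sub (d2.const_mul 2)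
  have z1 := fderiv_pushCoeff_of_mem_vertical (w := w) hU hY (j := j) (by omega)
    (HV j (by omega)) hp (vertical_antitone (by omega) hev)
  have z2 := fderiv_pushCoeff_of_mem_vertical (w := w) hU hY (j := j + 1) (by omega)
    (HV (j + 1) (by omega)) hp hev
  have h0 := fderiv_eq_zero_of_hyperplane hU (e := e) hp hx
    (partialVec_of_ne fun h => by have := congrArg Fin.val h; omega)
    (dYx.fun_sub (hc.fun_mul d)) (fun q hq hqx => by
      have := symmetry_xIdx_of_two_one hU hY hP h1j (by omega) hw hw' hq hqx
      linear_combination this)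
  rw [fderiv_fun_sub dYx (hc.fun_mul d), fderiv_fun_mul hc d, fderiv_fun_sub d1 (d2.const_mul 2),
    fderiv_const_mul d2] at h0
  have he1 : e (xIdx r (j + 2)) = 1 := partialVec_self _
  simp only [sub_apply, add_apply, smul_apply, fderiv_coord, smul_eq_mul, z1, z2,
    fderiv_apply_coord dY, mul_zero, zero_add, sub_zero, he1] at h0
  have hz : ekrField r w (j + 3) p = e := by
    have h := ekrField_succ_two hw'' p
    rw [show j + 2 + 1 = j + 3 from rfl, hx', hy'] at h
    simpa using h
  have hpv : pivot r w (j + 3) = xIdx r (j + 2) := by rw [pivot, if_pos hw'']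
  have h4 : pushCoeff w Y (j + 3) p = fderiv ℝ Y p e (xIdx r (j + 2)) := by
    rw [pushCoeff, hz, hpv]
  rw [h4]
  linear_combination h0

/-- For the initial letters `1.2`, the coefficient of `Z[2]` at a point with `x¹ = x² = y² = 0`. -/
theorem pushCoeff_symmetry_two (hU : IsOpen U) (hY : ContDiffOn ℝ ∞ Y U)
    (hP : InfinitesimallyPreserves w Y U r) (hr : 2 ≤ r)
    (hw : w.getD 0 1 = 1) (hw' : w.getD 1 1 = 2) {p : EKRSpace r} (hp : p ∈ U)
    (hx : p (xIdx r 1) = 0) (hx' : p (xIdx r 2) = 0) (hy' : p (yIdx r 2) = 0) :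
    pushCoeff w Y 2 p
      = fderiv ℝ Y p (partialVec (xIdx r 0)) (xIdx r 0) - pushCoeff w Y 1 p := by
  have H := fun i (hi : i ≤ r) => infinitesimallyPreserves_of_le hU hY hP hi
  have HV := fun i (hi : i + 1 ≤ r) q (hq : q ∈ U) v (hv : v ∈ SpecialFlag.vertical r (i + 1)) =>
    (H (i + 1) hi).vertical hU hY hi hq hv
  set e : EKRSpace r := partialVec (xIdx r 1) with he
  have x0 := xIdx_val (r := r) (j := 0) (by omega)
  have x1 := xIdx_val (r := r) (j := 1) (by omega)
  have hev : e ∈ SpecialFlag.vertical r 1 := partialVec_mem_vertical (by omega)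
  have he1 : e (xIdx r 1) = 1 := partialVec_self _
  have he2 : e (yIdx r 1) = 0 := partialVec_of_ne (xIdx_ne_yIdx (by omega) (by omega)).symm
  have hc : DifferentiableAt ℝ (fun q : EKRSpace r => q (xIdx r 1)) p :=
    differentiableAt_apply _ p
  have dY : DifferentiableAt ℝ Y p :=
    (hY.contDiffAt (hU.mem_nhds hp)).differentiableAt (by simp)
  have dYx : DifferentiableAt ℝ (fun q => Y q (xIdx r 1)) p := (differentiableAt_pi.1 dY) _
  have d := differentiableAt_pushCoeff (w := w) hU hY 1 hp
  have ee : (fun q => fderiv ℝ Y q (ekrField r w 1 q) (xIdx r 0)) =ᶠ[𝓝 p]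
      fun q => Y q (xIdx r 1) + pushCoeff w Y 1 q * q (xIdx r 1) :=
    Filter.eventually_of_mem (hU.mem_nhds hp)
      fun q hq => (H 1 (by omega)).xIdx_of_one (by omega) hw hq
  -- Differentiating along ∂_{x^1} turns Z[1] into ∂_{x^0} on the left, which is where B_{x^0}
  -- enters; x^1 = 0 removes the derivative of b_1 on the right.
  have e1 := congrArg (fun L : EKRSpace r →L[ℝ] ℝ => L e) ee.fderiv_eq
  rw [fderiv_fderiv_ekrField_apply hU hY 1 hp
      (fun q hq => (HV 0 (by omega) q hq e hev) _ (by omega)),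
    fderiv_fun_add dYx (d.fun_mul hc), fderiv_fun_mul d hc, fderiv_ekrField_succ_one hw,
    fderiv_ekrField_eq_zero (by omega) p hev] at e1
  simp only [add_apply, smul_apply, fderiv_coord, smul_eq_mul, hx, add_zero,
    fderiv_apply_coord dY, zero_add, he1, he2, one_smul, zero_smul, mul_one] at e1
  have hz : ekrField r w 2 p = e := by
    have h := ekrField_succ_two hw' p
    rw [show 1 + 1 = 2 from rfl, hx', hy'] at h
    simpa using h
  have hpv : pivot r w 2 = xIdx r 1 := by rw [pivot, if_pos hw']
  have h4 : pushCoeff w Y 2 p = fderiv ℝ Y p e (xIdx r 1) := by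
    rw [pushCoeff, hz, hpv]
  rw [h4]
  linear_combination -e1

end Symmetry

theorem symmetry_Delta7 {c : ℝ} {U : Set (EKRSpace 7)} {Y : EKRSpace 7 → EKRSpace 7}
    (hU : IsOpen U) (hp : pointP c ∈ U) (hY : IsInfinitesimalSymmetry Delta7 U Y)
    (h0 : ∀ k, k ≠ xIdx 7 7 → Y (pointP c) k = 0) :
    fderiv ℝ Y (pointP c) (partialVec (tIdx 7)) (tIdx 7) = 0 ∧
    fderiv ℝ Y (pointP c) (partialVec (xIdx 7 0)) (xIdx 7 0) = 0 ∧
    Y (pointP c) (xIdx 7 7) = 0 := by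
  obtain ⟨hY, hP⟩ := hY
  rw [Delta7, ekrDistribution_eq] at hP
  have hP' := infinitesimallyPreserves_of_preserves hU hP
  have H := fun i (hi : i ≤ 7) => infinitesimallyPreserves_of_le hU hY hP' hi
  have A := fun j h1 h2 h3 h4 h5 =>
    symmetry_xIdx_of_two_one hU hY hP' (j := j) h1 h2 h3 h4 hp h5
  have B := fun j h1 h2 h3 h4 h5 h6 h7 h8 =>
    pushCoeff_symmetry_of_two_one_two hU hY hP' (j := j) h1 h2 h3 h4 h5 hp h6 h7 h8
  have S := fun j h1 h2 => pushCoeff_succ_of_one (φ := Y) (q := pointP c) (w := code7) (j := j + 1)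
    h1 h2 fun v hv => (H (j + 1) (by omega)).vertical hU hY (by omega) hp hv
  have A1 := A 1 (by norm_num) (by norm_num) rfl rfl (by simp [pointP_xIdx])
  have A3 := A 3 (by norm_num) (by norm_num) rfl rfl (by simp [pointP_xIdx])
  have A5 := A 5 (by norm_num) (by norm_num) rfl rfl (by simp [pointP_xIdx])
  have B1 := B 1 (by norm_num) (by norm_num) rfl rfl rfl (by simp [pointP_xIdx])
    (by simp [pointP_xIdx]) (by simp [pointP_yIdx])
  have B3 := B 3 (by norm_num) (by norm_num) rfl rfl rfl (by simp [pointP_xIdx])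
    (by simp [pointP_xIdx]) (by simp [pointP_yIdx])
  have S3 := S 1 (by norm_num) rfl
  have S5 := S 3 (by norm_num) rfl
  have T := pushCoeff_symmetry_two hU hY hP' (by norm_num) rfl rfl hp (by simp [pointP_xIdx])
    (by simp [pointP_xIdx]) (by simp [pointP_yIdx])
  -- The frozen components are those of x^3 and x^5; the component of x^7, on the left of `A5`,
  -- remains free.
  rw [h0 _ (by decide)] at A1 A3
  simp [pointP_xIdx] at A1 A3 A5 B1 B3 S3 S5
  have hz : ekrField 7 code7 1 (pointP c) = partialVec (tIdx 7) := by
    rw [ekrField_succ_one (by decide) (by decide), pointP_xIdx c (by norm_num),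
      pointP_yIdx c (by norm_num)]
    simp [ekrField]
  have hα : pushCoeff code7 Y 1 (pointP c)
      = fderiv ℝ Y (pointP c) (partialVec (tIdx 7)) (tIdx 7) := by
    rw [pushCoeff, hz]
    rfl
  rw [← hα]
  -- Freezing x^3 gives b_1 = 2 b_2, hence b_4 = 0; freezing x^5 gives b_3 = 2 b_4 = 0, hence b_6 =
  -- 0. With b_2 = b_3 and b_5 = b_4 all vanish, and B_{x^0} = b_1 + b_2.
  refine ⟨by linarith, by linarith, ?_⟩
  rw [A5, show pushCoeff code7 Y 5 (pointP c) - 2 * pushCoeff code7 Y 6 (pointP c) = 0 by linarith,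
    mul_zero]

end SpecialFlag

end

theorem theorem3 :
    -- the germs at the points `P_c` belong to the singularity class 1.2.1.2.1.2.1
    (∀ c : ℝ, SpecialFlag.HasSingularityClass 7 SpecialFlag.Delta7 (SpecialFlag.pointP c)
      [1, 2, 1, 2, 1, 2, 1]) ∧
    -- and are pairwise non-equivalent
    (∀ c c' : ℝ, c ≠ c' → ¬ SpecialFlag.GermEquivalent
      SpecialFlag.Delta7 (SpecialFlag.pointP c) SpecialFlag.Delta7 (SpecialFlag.pointP c')) ∧
    -- infinitesimal symmetries that freeze all coordinates of `P_c` but `x⁷` also freeze `x⁷`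
    (∀ (c : ℝ) (U : Set (SpecialFlag.EKRSpace 7))
      (Y : SpecialFlag.EKRSpace 7 → SpecialFlag.EKRSpace 7),
      IsOpen U → SpecialFlag.pointP c ∈ U →
      SpecialFlag.IsInfinitesimalSymmetry SpecialFlag.Delta7 U Y →
      (∀ k, k ≠ SpecialFlag.xIdx 7 7 → Y (SpecialFlag.pointP c) k = 0) →
      ∀ At Bx : ℝ,
        At = fderiv ℝ (fun q => Y q (SpecialFlag.tIdx 7)) (SpecialFlag.pointP c)
          (SpecialFlag.partialVec (SpecialFlag.tIdx 7)) →
        Bx = fderiv ℝ (fun q => Y q (SpecialFlag.xIdx 7 0)) (SpecialFlag.pointP c)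
          (SpecialFlag.partialVec (SpecialFlag.xIdx 7 0)) →
        At = 0 ∧ Bx = 0 ∧
        Y (SpecialFlag.pointP c) (SpecialFlag.xIdx 7 7) = 3 * c * (At - Bx) ∧
        Y (SpecialFlag.pointP c) (SpecialFlag.xIdx 7 7) = 0) := by
  refine ⟨SpecialFlag.hasSingularityClass_Delta7,
    fun c c' h => SpecialFlag.not_germEquivalent_Delta7 h, ?_⟩
  rintro c U Y hU hp hY h0 At Bx hAt hBx
  have dY : DifferentiableAt ℝ Y (SpecialFlag.pointP c) :=
    (hY.1.contDiffAt (hU.mem_nhds hp)).differentiableAt (by simp)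
  rw [SpecialFlag.fderiv_apply_coord dY] at hAt hBx
  obtain ⟨h1, h2, h3⟩ := SpecialFlag.symmetry_Delta7 hU hp hY h0
  rw [h1] at hAt
  rw [h2] at hBx
  -- Once A_t and B_{x^0} vanish, the formula with 3c reads 0 = 0.
  refine ⟨hAt, hBx, ?_, h3⟩
  rw [h3, hAt, hBx]
  ring
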